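/- Let $\mathbb{C}_\infty=\mathbb{C}\cup\{\infty\}$ be the Riemann sphere, let $\sigma$ be the spherical (great-circle) metric on it, and let $D\subseteq\mathbb{C}_\infty$ be a domain (a nonempty connected open set). Let $\mathcal{M}(D)$ be the set of meromorphic functions on $D$, regarded as maps $D\to\mathbb{C}_\infty$ (with value $\infty$ at the poles); the constant $\infty$ is not a member. Let $\mathcal{F}\subseteq\mathcal{M}(D)$. Suppose that there is an $\epsilon>0$ and that for each $f\in\mathcal{F}$ there are three functions $a_{1f},a_{2f},a_{3f}\in\mathcal{M}(D)\cup\{\infty\}$ (each is meromorphic on $D$ or identically $\infty$) such that $$\sigma(a_{jf}(z),a_{kf}(z))\ge\epsilon\qquad\text{for all } f\in\mathcal{F},\ j\neq k,\ z\in D .$$ Suppose further that for all $f,g\in\mathcal{F}$ and each $j\in\{1,2,3\}$ the functions $f-a_{jf}$ and $g-a_{jg}$ share $0$ in $D$, that is, for every $z\in D$, with all values taken in $\mathbb{C}_\infty$, $$f(z)=a_{jf}(z)\iff g(z)=a_{jg}(z).$$ Then $\mathcal{F}$ is normal in $D$: every sequence in $\mathcal{F}$ has a subsequence that converges locally uniformly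 on $D$, with respect to $\sigma$, to a function that is either meromorphic on $D$ or identically $\infty$. -/

import Mathlib

open scoped Topology OnePoint

noncomputable section

namespace SphereNormal

/-- The extended complex plane `ℂ ∪ {∞}` with its usual (one-point compactification) topology. -/
abbrev Sphere : Type := OnePoint ℂ

/-- The coordinate of a finite point of the sphere; the value at `∞` is a convention that is never
used, since this is only applied near points where the argument is finite. -/
def finiteCoord : Sphere → ℂ
  | ∞ => 0
  | (z : ℂ) => z

/-- The inversion `z ↦ 1 / z` of the sphere, which exchanges `0` and `∞`. -/
def inversion : Sphere → Sphere
  | ∞ => ((0 : ℂ) : Sphere)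
  | (z : ℂ) => if z = 0 then ∞ else ((z⁻¹ : ℂ) : Sphere)

/-- The spherical distance: the great-circle distance on the unit sphere, transported to `ℂ ∪ {∞}`
by stereographic projection (so that antipodal points are at distance `π`). -/
def sphericalDist : Sphere → Sphere → ℝ
  | ∞, ∞ => 0
  | ∞, (w : ℂ) => 2 * Real.arcsin (1 / √(1 + ‖w‖ ^ 2))
  | (z : ℂ), ∞ => 2 * Real.arcsin (1 / √(1 + ‖z‖ ^ 2))
  | (z : ℂ), (w : ℂ) => 2 * Real.arcsin (‖z - w‖ / (√(1 + ‖z‖ ^ 2) * √(1 + ‖w‖ ^ 2)))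

/-- A sphere-valued function of a complex variable is holomorphic at `z` as a map into the sphere:
it is continuous at `z`, and `f` (if `f z` is finite) resp. `1 / f` (if `f z = ∞`) is
analytic at `z`. -/
def HolomorphicAtFinite (f : ℂ → Sphere) (z : ℂ) : Prop :=
  ContinuousAt f z ∧
    (f z ≠ ∞ → AnalyticAt ℂ (fun w => finiteCoord (f w)) z) ∧
    (f z = ∞ → AnalyticAt ℂ (fun w => finiteCoord (inversion (f w))) z)

/-- A map of the sphere to itself is holomorphic at `p`; at `p = ∞` the local coordinate is
`w = 1 / z`. -/
def HolomorphicAt (f : Sphere → Sphere) : Sphere → Prop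
  | ∞ => HolomorphicAtFinite (fun w : ℂ => f (inversion (w : Sphere))) 0
  | (z : ℂ) => HolomorphicAtFinite (fun w : ℂ => f (w : Sphere)) z

/-- A domain of the sphere: a nonempty connected open subset. -/
def IsDomainSet (D : Set Sphere) : Prop := IsOpen D ∧ IsConnected D

/-- `f` is identically `∞` on `D`. -/
def IdenticallyInfty (f : Sphere → Sphere) (D : Set Sphere) : Prop := ∀ z ∈ D, f z = ∞

/-- `f` is a meromorphic function on the domain `D` (poles being taken to `∞`): a holomorphic map
from `D` to the sphere that is not identically `∞`. Values outside `D` play no role. -/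
def IsMeromorphicOn (f : Sphere → Sphere) (D : Set Sphere) : Prop :=
  (∀ z ∈ D, HolomorphicAt f z) ∧ ¬ IdenticallyInfty f D

/-- The functions that are meromorphic on `D` or identically `∞` on `D`. -/
def IsMeromorphicOrInfty (f : Sphere → Sphere) (D : Set Sphere) : Prop :=
  IsMeromorphicOn f D ∨ IdenticallyInfty f D

/-- Locally uniform convergence on `D` with respect to the spherical metric: every point of `D` has
a neighbourhood in `D` on which the convergence is uniform. -/
def TendstoLocallyUniformlySpherically (u : ℕ → Sphere → Sphere) (g : Sphere → Sphere)
    (D : Set Sphere) : Prop :=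
  ∀ z ∈ D, ∃ V ∈ 𝓝[D] z, ∀ δ : ℝ, 0 < δ →
    ∃ N : ℕ, ∀ n ≥ N, ∀ y ∈ V, sphericalDist (u n y) (g y) < δ

/-- A family of functions is normal on `D` if every sequence in it has a subsequence that converges
locally uniformly on `D`, in the spherical metric, to a function that is meromorphic on `D` or
identically `∞` on `D`. -/
def IsNormalFamily (F : Set (Sphere → Sphere)) (D : Set Sphere) : Prop :=
  ∀ u : ℕ → Sphere → Sphere, (∀ n, u n ∈ F) →
    ∃ φ : ℕ → ℕ, StrictMono φ ∧ ∃ g : Sphere → Sphere,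
      IsMeromorphicOrInfty g D ∧ TendstoLocallyUniformlySpherically (fun n => u (φ n)) g D

/-- `f - a` and `g - b` share `0` in `D`, multiplicities being ignored: `f` and `a` take the same
value in `ℂ ∪ {∞}` at exactly those points of `D` at which `g` and `b` do. For `a` identically `∞`,
a zero of `f - a` is a pole of `f`. -/
def DifferencesShareZero (f a g b : Sphere → Sphere) (D : Set Sphere) : Prop :=
  ∀ z ∈ D, f z = a z ↔ g z = b z

end SphereNormal

end

/-! Normality is a local question, so the argument takes place on a small disc in a chart. The cross
ratio of `f` with its three targets takes the values 0, 1, ∞ exactly where `f` meets the first,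
second and third target. Hence the cross ratios of all members share three fixed values, even though
the targets vary with `f`.

Compare these cross ratios with a single reference one near the centre of the disc. If the reference
is locally constant with value 0, 1 or ∞, all of them are that constant. If it omits the three
values, so do all, and Schottky's theorem bounds each one or its reciprocal
(`exists_bound_of_omits_zero_one`). Otherwise one of the values is taken, only at the centre. A
Möbius change makes that value 0, and pulling back by the exponential reduces the bound on a circle
to Schottky's theorem, while the maximum principle fills in the disc
(`exists_bound_of_zero_only_at_center`).

Returning from cross ratios to `f` requires control of the targets and of poles. Both are handled by
homogeneous coordinates that are holomorphic, bounded, and bounded away from (0, 0) (`BoundedLift`).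
The targets have such coordinates merely because they stay away from each other
(`boundedLift_of_le_chord`), and solving the cross ratio equation preserves the bounds
(`BoundedLift.of_crossRatio`). Montel's theorem for the two coordinates gives local convergence, and
a diagonal sequence over countably many discs makes it global (`isNormalFamily_of_local`). -/

namespace SphereNormal

open Complex Metric Set Filter

/-! ### Schottky's theorem by way of iterated cosines and a Bloch-type estimate -/

/-- A nonvanishing holomorphic function on a disc has a holomorphic logarithm. -/
theorem exists_exp_eq_of_ne_zero {f : ℂ → ℂ} {c : ℂ} {r : ℝ}
    (hf : DifferentiableOn ℂ f (ball c r)) (h0 : ∀ z ∈ ball c r, f z ≠ 0) :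
    ∃ g : ℂ → ℂ, DifferentiableOn ℂ g (ball c r) ∧ ∀ z ∈ ball c r, exp (g z) = f z := by
  rcases le_or_gt r 0 with hr | hr
  · exact ⟨f, hf, by simp [ball_eq_empty.2 hr]⟩
  have hd : DifferentiableOn ℂ (fun z => deriv f z / f z) (ball c r) :=
    (hf.deriv isOpen_ball).div hf h0
  obtain ⟨g, hgc, hg⟩ := hd.isExactOn_ball.with_val_at c (log (f c))
  have hgd : DifferentiableOn ℂ g (ball c r) := fun z hz =>
    (hg z hz).differentiableAt.differentiableWithinAt
  have hD : ∀ z ∈ ball c r, HasDerivAt (fun z => f z * exp (-g z)) 0 z := by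
    intro z hz
    have h1 := (hf.differentiableAt (isOpen_ball.mem_nhds hz)).hasDerivAt
    have h2 := h1.mul (hg z hz).neg.cexp
    refine h2.congr_deriv ?_
    have := h0 z hz
    field_simp
    ring
  have hcc : c ∈ ball c r := mem_ball_self hr
  refine ⟨g, hgd, fun z hz => ?_⟩
  have := isOpen_ball.is_const_of_deriv_eq_zero (convex_ball c r).isPreconnected
    (fun z hz => (hD z hz).differentiableAt.differentiableWithinAt)
    (fun z hz => (hD z hz).deriv) hz hcc
  rw [hgc, exp_neg, exp_neg, exp_log (h0 c hcc), mul_inv_cancel₀ (h0 c hcc),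
    mul_inv_eq_one₀ (exp_ne_zero _)] at this
  exact this.symm

/-- If `Im w ≥ 0`, then `exp (-iw)` has modulus `exp (Im w) ≥ 1 + Im w`, while `exp (iw)` has
modulus at most 1; their sum is `2 cos w`. Evenness of the cosine covers the other half-plane. -/
theorem abs_im_le_two_mul_norm_cos (w : ℂ) : |w.im| ≤ 2 * ‖cos w‖ := by
  have key : ∀ w : ℂ, 0 ≤ w.im → w.im ≤ 2 * ‖cos w‖ := by
    intro w hw
    have h1 : exp (-w * I) = 2 * cos w - exp (w * I) := by rw [two_cos]; ring
    have h2 := norm_sub_le (2 * cos w) (exp (w * I))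
    rw [← h1, norm_exp, norm_exp, norm_mul] at h2
    have h3 : (-w * I).re = w.im := by simp
    have h4 : (w * I).re = -w.im := by simp
    rw [h3, h4] at h2
    have h5 := Real.add_one_le_exp w.im
    have h6 : Real.exp (-w.im) ≤ 1 := Real.exp_le_one_iff.2 (by linarith)
    have h7 : ‖(2 : ℂ)‖ = 2 := by simp
    rw [h7] at h2
    linarith
  rcases le_total 0 w.im with h | h
  · rw [abs_of_nonneg h]; exact key w h
  · rw [abs_of_nonpos h, ← cos_neg]
    simpa using key (-w) (by simpa using h)

theorem norm_cos_le_exp_norm (w : ℂ) : ‖cos w‖ ≤ Real.exp ‖w‖ := by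
  have h1 : ‖exp (w * I)‖ ≤ Real.exp ‖w‖ := by
    simpa using norm_exp_le_exp_norm (w * I)
  have h2 : ‖exp (-w * I)‖ ≤ Real.exp ‖w‖ := by
    simpa using norm_exp_le_exp_norm (-w * I)
  have h3 := norm_add_le (exp (w * I)) (exp (-w * I))
  rw [← two_cos, norm_mul] at h3
  have h7 : ‖(2 : ℂ)‖ = 2 := by simp
  rw [h7] at h3
  linarith

/-- A holomorphic function on a disc omitting `±1` is of the form `cos (π G)`, with a bound for `G`
at the centre. -/
theorem exists_cos_pi_mul_eq {F : ℂ → ℂ} {c : ℂ} {r : ℝ} (hr : 0 < r)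
    (hF : DifferentiableOn ℂ F (ball c r)) (h1 : ∀ z ∈ ball c r, F z ^ 2 ≠ 1) :
    ∃ G : ℂ → ℂ, DifferentiableOn ℂ G (ball c r) ∧
      (∀ z ∈ ball c r, cos (Real.pi * G z) = F z) ∧ ‖G c‖ ≤ 1 + 2 * ‖F c‖ := by
  have hpi : (Real.pi : ℂ) ≠ 0 := by exact_mod_cast Real.pi_ne_zero
  -- Here `exp (s / 2)` is a holomorphic square root of `1 - F²`. The functions `F ± i √(1 - F²)`
  -- are mutually inverse, so the first has a logarithm `t`, and `F = cos (t / i)`.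
  obtain ⟨s, hs, hs'⟩ := exists_exp_eq_of_ne_zero (f := fun z => 1 - F z ^ 2)
    ((differentiableOn_const 1).sub (hF.pow 2)) (fun z hz => sub_ne_zero.2 (h1 z hz).symm)
  have hsq : ∀ z ∈ ball c r, exp (s z / 2) ^ 2 = 1 - F z ^ 2 := by
    intro z hz
    rw [← hs' z hz, ← exp_nat_mul]
    congr 1; push_cast; ring
  have hmul : ∀ z ∈ ball c r,
      (F z + exp (s z / 2) * I) * (F z - exp (s z / 2) * I) = 1 := by
    intro z hz
    linear_combination hsq z hz - exp (s z / 2) ^ 2 * I_sq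
  obtain ⟨t, ht, ht'⟩ := exists_exp_eq_of_ne_zero (f := fun z => F z + exp (s z / 2) * I)
    (hF.add ((hs.div_const 2).cexp.mul_const I))
    (fun z hz => left_ne_zero_of_mul_eq_one (hmul z hz))
  have hcos : ∀ z ∈ ball c r, cos (Real.pi * (t z / (Real.pi * I))) = F z := by
    intro z hz
    have e1 : Real.pi * (t z / (Real.pi * I)) * I = t z := by
      have := I_ne_zero; field_simp
    have e2 : exp (-t z) = F z - exp (s z / 2) * I := by
      rw [exp_neg, ht' z hz]; exact inv_eq_of_mul_eq_one_right (hmul z hz)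
    rw [cos, neg_mul, e1, e2, ht' z hz]; ring
  -- Subtracting the even integer `2k` from `G` leaves `cos (π G)` unchanged and brings `Re G(c)`
  -- into `[-1, 1]`.
  set k : ℤ := round ((t c / (Real.pi * I)).re / 2) with hk
  have hper : ∀ z ∈ ball c r, cos (Real.pi * (t z / (Real.pi * I) - 2 * k)) = F z := by
    intro z hz
    rw [← hcos z hz, ← cos_sub_int_mul_two_pi (Real.pi * (t z / (Real.pi * I))) k]
    congr 1; ring
  refine ⟨fun z => t z / (Real.pi * I) - 2 * k, (ht.div_const _).sub_const _, hper, ?_⟩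
  have hc := hper c (mem_ball_self hr)
  have hre : |(t c / (Real.pi * I) - 2 * k).re| ≤ 1 := by
    have h2 := abs_sub_round ((t c / (Real.pi * I)).re / 2)
    have h3 : (t c / (Real.pi * I) - 2 * k).re =
        2 * ((t c / (Real.pi * I)).re / 2 - round ((t c / (Real.pi * I)).re / 2)) := by
      rw [sub_re, ← hk]
      have : ((2 : ℂ) * k).re = 2 * k := by simp
      rw [this]; ring
    rw [h3, abs_mul, abs_two]
    linarith
  have him : |(t c / (Real.pi * I) - 2 * k).im| ≤ 2 * ‖F c‖ := by
    have h2 := abs_im_le_two_mul_norm_cos (Real.pi * (t c / (Real.pi * I) - 2 * k))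
    rw [hc, im_ofReal_mul, abs_mul, abs_of_pos Real.pi_pos] at h2
    nlinarith [Real.pi_gt_three, abs_nonneg (t c / (Real.pi * I) - 2 * k).im]
  exact (norm_le_abs_re_add_abs_im _).trans (add_le_add hre him)

/-- A form of Bloch's theorem: a large derivative at the centre forces the image to contain a disc
of radius 1. At a maximum point `p` of `(r/2 - |p - c|) |g'(p)|` the derivative varies slowly, so
`g` is close to an affine map near `p` and covers a disc about `g p` of radius `A δ / 24`. A
violation of the bound gives `A δ > 32`. -/
theorem norm_deriv_mul_le_of_image_omits {g : ℂ → ℂ} {c : ℂ} {r : ℝ} (hr : 0 < r)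
    (hg : DifferentiableOn ℂ g (ball c r))
    (h : ∀ w, ∃ w' ∈ ball w 1, ∀ z ∈ ball c r, g z ≠ w') : ‖deriv g c‖ * r ≤ 128 := by
  set φ : ℂ → ℝ := fun p => (r / 2 - dist p c) * ‖deriv g p‖ with hφ
  have hsub : closedBall c (r / 2) ⊆ ball c r := closedBall_subset_ball (by linarith)
  have hdg := hg.deriv isOpen_ball
  have hcont : ContinuousOn φ (closedBall c (r / 2)) :=
    (continuousOn_const.sub (continuous_id.dist continuous_const).continuousOn).mul
      (hdg.continuousOn.mono hsub).norm
  obtain ⟨p, hp, hmax⟩ := (isCompact_closedBall c (r / 2)).exists_isMaxOn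
    ⟨c, mem_closedBall_self (by linarith)⟩ hcont
  have hc : r / 2 * ‖deriv g c‖ ≤ φ p := by
    have := hmax (mem_closedBall_self (by linarith) : c ∈ closedBall c (r / 2))
    simpa [hφ] using this
  by_contra! hlt
  set A := ‖deriv g p‖ with hA
  set δ := (r / 2 - dist p c) / 2 with hδ
  have hAδ : φ p = 2 * δ * A := by simp only [hφ, hδ, hA]; ring
  have hδ0 : 0 ≤ δ := by have := mem_closedBall.1 hp; simp only [hδ]; linarith
  have hA0 : 0 ≤ A := norm_nonneg _
  have hAδ' : 32 < A * δ := by nlinarith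
  have hδp : 0 < δ := by
    rcases hδ0.lt_or_eq with h | h
    · exact h
    · rw [← h] at hAδ'; simp at hAδ'; linarith
  have hAp : 0 < A := by
    rcases hA0.lt_or_eq with h | h
    · exact h
    · rw [← h] at hAδ'; simp at hAδ'; linarith
  have hball : ∀ w ∈ ball p δ, w ∈ closedBall c (r / 2) ∧ δ ≤ r / 2 - dist w c := by
    intro w hw
    have h1 := dist_triangle w p c
    have h2 := mem_ball.1 hw
    have h3 : dist w c ≤ r / 2 - δ := by linarith
    exact ⟨mem_closedBall.2 (by linarith), by linarith⟩
  have hder : ∀ w ∈ ball p δ, ‖deriv g w‖ ≤ 2 * A := by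
    intro w hw
    obtain ⟨hw1, hw2⟩ := hball w hw
    have h1 : (r / 2 - dist w c) * ‖deriv g w‖ ≤ 2 * δ * A := hAδ ▸ hmax hw1
    have h2 : δ * ‖deriv g w‖ ≤ δ * (2 * A) := by
      nlinarith [norm_nonneg (deriv g w)]
    exact le_of_mul_le_mul_left h2 hδp
  have hballr : ball p δ ⊆ ball c r := fun w hw => hsub (hball w hw).1
  have hschwarz : ∀ w ∈ ball p δ, ‖deriv g w - deriv g p‖ ≤ 3 * A / δ * dist w p := by
    intro w hw
    rw [← dist_eq_norm]
    refine dist_le_div_mul_dist_of_mapsTo_ball (hdg.mono hballr) (fun v hv => ?_) hw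
    rw [mem_closedBall, dist_eq_norm]
    have := norm_sub_le (deriv g v) (deriv g p)
    have := hder v hv
    linarith
  -- The radius `δ / 6` makes the Schwarz bound `3A/δ · |w - p|` for the variation of `g'` at most
  -- `A / 2`, half of `|g'(p)|`.
  have hsmall : closedBall p (δ / 6) ⊆ ball p δ := closedBall_subset_ball (by linarith)
  have hlip : ∀ w ∈ closedBall p (δ / 6),
      ‖(g w - deriv g p * w) - (g p - deriv g p * p)‖ ≤ A / 2 * ‖w - p‖ := by
    intro w hw
    refine (convex_closedBall p (δ / 6)).norm_image_sub_le_of_norm_hasDerivWithin_le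
      (f := fun w => g w - deriv g p * w) (f' := fun w => deriv g w - deriv g p)
      (fun v hv => ?_) (fun v hv => ?_) (mem_closedBall_self (by linarith)) hw
    · have h1 := (hg.differentiableAt
        (isOpen_ball.mem_nhds (hballr (hsmall hv)))).hasDerivAt
      have h2 := h1.sub ((hasDerivAt_id v).const_mul (deriv g p))
      simp only [mul_one] at h2
      exact h2.hasDerivWithinAt
    · refine (hschwarz v (hsmall hv)).trans ?_
      have : dist v p ≤ δ / 6 := mem_closedBall.1 hv
      calc 3 * A / δ * dist v p ≤ 3 * A / δ * (δ / 6) := by gcongr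
        _ = A / 2 := by field_simp; norm_num
  have hlow : ∀ w ∈ closedBall p (δ / 6), A / 2 * ‖w - p‖ ≤ ‖g w - g p‖ := by
    intro w hw
    have h1 := hlip w hw
    have h2 : deriv g p * (w - p) =
        (g w - g p) - ((g w - deriv g p * w) - (g p - deriv g p * p)) := by ring
    have h3 := norm_sub_le (g w - g p) ((g w - deriv g p * w) - (g p - deriv g p * p))
    rw [← h2, norm_mul, ← hA] at h3
    linarith
  have hball2 : ball (g p) (A * δ / 12 / 2) ⊆ g '' closedBall p (δ / 6) := by
    refine DiffContOnCl.ball_subset_image_closedBall ?_ (by linarith) (fun z hz => ?_) ?_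
    · refine DifferentiableOn.diffContOnCl ?_
      rw [closure_ball p (by linarith)]
      exact hg.mono (hsmall.trans hballr)
    · have h1 := hlow z (sphere_subset_closedBall hz)
      rw [mem_sphere_iff_norm.1 hz] at h1
      linarith
    · have h1 : ∀ᶠ z in 𝓝[≠] p, g z ≠ g p := by
        filter_upwards [self_mem_nhdsWithin,
          mem_nhdsWithin_of_mem_nhds (closedBall_mem_nhds p (by linarith : 0 < δ / 6))] with z hz hz'
        have h2 := hlow z hz'
        intro h3
        rw [h3, sub_self, norm_zero] at h2
        have h4 : 0 < ‖z - p‖ := norm_pos_iff.2 (sub_ne_zero.2 hz)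
        nlinarith
      exact h1.frequently.filter_mono nhdsWithin_le_nhds
  obtain ⟨w', hw', hne⟩ := h (g p)
  obtain ⟨z, hz, hzw⟩ := hball2 (ball_subset_ball (by nlinarith) hw')
  exact hne z (hballr (hsmall hz)) hzw

/-- Take `cosh S = ⌊cosh T⌋`. Since this floor is at least 1, `cosh T < 2 cosh S`, hence `exp T < 4
exp S`, and `4 < e²`. -/
theorem exists_cosh_eq_natCast {T : ℝ} (hT : 0 ≤ T) :
    ∃ S : ℝ, S ≤ T ∧ T - S < 2 ∧ ∃ n : ℕ, Real.cosh S = n := by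
  have h1 := Real.one_le_cosh T
  have hn1 : 1 ≤ ⌊Real.cosh T⌋₊ := Nat.le_floor (by simp)
  have hn1' : (1 : ℝ) ≤ ⌊Real.cosh T⌋₊ := by exact_mod_cast hn1
  have hn2 : (⌊Real.cosh T⌋₊ : ℝ) ≤ Real.cosh T := Nat.floor_le (by linarith)
  have hn3 := Nat.lt_floor_add_one (Real.cosh T)
  obtain ⟨S, hS, hSn⟩ := intermediate_value_Icc hT Real.continuous_cosh.continuousOn
    (show (⌊Real.cosh T⌋₊ : ℝ) ∈ Icc (Real.cosh 0) (Real.cosh T) by simp [hn1', hn2])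
  refine ⟨S, hS.2, ?_, _, hSn⟩
  have h2 : Real.cosh T < 2 * Real.cosh S := by rw [hSn]; linarith
  rw [Real.cosh_eq, Real.cosh_eq] at h2
  have h3 : Real.exp (-S) ≤ Real.exp S := Real.exp_le_exp.2 (by linarith [hS.1])
  have h4 : Real.exp T < 4 * Real.exp S := by linarith [Real.exp_pos (-T)]
  by_contra! h5
  have h6 : Real.exp (S + 1 + 1) ≤ Real.exp T := Real.exp_le_exp.2 (by linarith)
  rw [Real.exp_add, Real.exp_add] at h6
  have h7 := Real.exp_one_gt_d9
  have h8 := Real.exp_pos S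
  nlinarith [mul_pos h8 (Real.exp_pos 1)]

/-- The points at which `cos (π w)` is an integer meet every disc of radius one. -/
theorem exists_mem_ball_cos_pi_mul_eq_intCast (w : ℂ) :
    ∃ w' ∈ ball w 1, ∃ n : ℤ, cos (Real.pi * w') = n := by
  have key : ∀ w : ℂ, 0 ≤ w.im → ∃ w' ∈ ball w 1, ∃ n : ℤ, cos (Real.pi * w') = n := by
    intro w hw
    obtain ⟨S, hST, hTS, n, hn⟩ := exists_cosh_eq_natCast
      (mul_nonneg Real.pi_pos.le hw : 0 ≤ Real.pi * w.im)
    -- With an integer `m` as real part, `cos (π m + i S) = ± cosh S` is an integer. The offsets are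
    -- at most 1/2 and 2/3, and `1/4 + 4/9 < 1`.
    refine ⟨⟨round w.re, S / Real.pi⟩, ?_, ?_⟩
    · rw [mem_ball, dist_comm, dist_eq_norm, ← sq_lt_one_iff₀ (norm_nonneg _), Complex.sq_norm,
        normSq_apply]
      have h1 := abs_sub_round w.re
      have h2 : w.im - S / Real.pi = (Real.pi * w.im - S) / Real.pi := by
        field_simp
      have h3 : 0 ≤ w.im - S / Real.pi := by
        rw [h2]; exact div_nonneg (by linarith) Real.pi_pos.le
      have h4 : w.im - S / Real.pi ≤ 2 / 3 := by
        rw [h2, div_le_iff₀ Real.pi_pos]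
        linarith [Real.pi_gt_three]
      have h5 := abs_le.1 h1
      simp only [sub_re, sub_im]
      nlinarith
    · have e : (Real.pi : ℂ) * ⟨round w.re, S / Real.pi⟩ =
          (S : ℂ) * I + (round w.re : ℤ) * Real.pi := by
        apply Complex.ext
        · simp [mul_comm]
        · simp; field_simp
      refine ⟨(round w.re).negOnePow * n, ?_⟩
      rw [e, cos_antiperiodic.add_int_mul_eq, cos_mul_I, ← ofReal_cosh, hn]
      push_cast
      rfl
  rcases le_total 0 w.im with h | h
  · exact key w h
  · obtain ⟨w', hw', n, hn⟩ := key (-w) (by simpa using h)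
    refine ⟨-w', ?_, n, by rw [mul_neg, cos_neg, hn]⟩
    rw [mem_ball, dist_eq_norm] at hw' ⊢
    rwa [← norm_neg, neg_sub', neg_neg] at hw'

/-- **Schottky's theorem**, in a qualitative form. -/
theorem exists_bound_of_omits_zero_one (M : ℝ) : ∃ C : ℝ, ∀ (f : ℂ → ℂ) (c : ℂ) (r : ℝ), 0 < r →
    DifferentiableOn ℂ f (ball c r) → (∀ z ∈ ball c r, f z ≠ 0 ∧ f z ≠ 1) → ‖f c‖ ≤ M →
    ∀ z ∈ closedBall c (r / 2), ‖f z‖ ≤ C := by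
  -- The bounds at the centre are `2M + 1` for `2f - 1`, and `x ↦ 1 + 2x` is applied for each of the
  -- two inverse cosines; 128 is the variation of `g` on the half disc.
  set K : ℝ := 1 + 2 * (1 + 2 * (2 * M + 1)) + 128 with hK
  refine ⟨(1 + Real.exp (Real.pi * Real.exp (Real.pi * K))) / 2, ?_⟩
  intro f c r hr hf hf01 hfc z hz
  have two : ‖(2 : ℂ)‖ = 2 := by simp
  -- As `2f - 1` omits ±1, it equals `cos (π G)`. Then `G` omits all integers, in particular ±1, so
  -- `G = cos (π g)`, and `g` omits every point where `cos (π w)` is an integer.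
  obtain ⟨G, hG, hGf, hGc⟩ := exists_cos_pi_mul_eq (F := fun z => 2 * f z - 1) hr
    ((hf.const_mul 2).sub_const 1) (fun z hz h => by
      have : f z * (f z - 1) = 0 := by linear_combination h / 4
      rcases mul_eq_zero.1 this with h | h
      · exact (hf01 z hz).1 h
      · exact (hf01 z hz).2 (sub_eq_zero.1 h))
  have hGint : ∀ z ∈ ball c r, ∀ n : ℤ, G z ≠ n := by
    intro z hz n hn
    have h1 := hGf z hz
    have h2 : cos (Real.pi * G z) ^ 2 = 1 := by
      have h3 := sin_sq_add_cos_sq (Real.pi * G z)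
      rw [hn, mul_comm, sin_int_mul_pi] at h3
      rw [hn, mul_comm]
      simpa using h3
    rw [h1] at h2
    have : f z * (f z - 1) = 0 := by linear_combination h2 / 4
    rcases mul_eq_zero.1 this with h | h
    · exact (hf01 z hz).1 h
    · exact (hf01 z hz).2 (sub_eq_zero.1 h)
  obtain ⟨g, hg, hgG, hgc⟩ := exists_cos_pi_mul_eq hr hG (fun z hz h => by
    rcases sq_eq_one_iff.1 h with h | h
    · exact hGint z hz 1 (by simpa using h)
    · exact hGint z hz (-1) (by simpa using h))
  have homit : ∀ w, ∃ w' ∈ ball w 1, ∀ z ∈ ball c r, g z ≠ w' := by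
    intro w
    obtain ⟨w', hw', n, hn⟩ := exists_mem_ball_cos_pi_mul_eq_intCast w
    exact ⟨w', hw', fun z hz h => hGint z hz n (by rw [← hgG z hz, h, hn])⟩
  have hder : ∀ v ∈ closedBall c (r / 2), ‖deriv g v‖ ≤ 256 / r := by
    intro v hv
    have hsub : ball v (r / 2) ⊆ ball c r :=
      ball_subset_ball' (by have := mem_closedBall.1 hv; linarith)
    have h1 := norm_deriv_mul_le_of_image_omits (half_pos hr) (hg.mono hsub) (fun w => by
      obtain ⟨w', hw', h⟩ := homit w
      exact ⟨w', hw', fun z hz => h z (hsub hz)⟩)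
    rw [le_div_iff₀ hr]; linarith
  have hclosed : closedBall c (r / 2) ⊆ ball c r := closedBall_subset_ball (by linarith)
  have hdiff : ‖g z - g c‖ ≤ 128 := by
    have h1 := (convex_closedBall c (r / 2)).norm_image_sub_le_of_norm_deriv_le (f := g)
      (fun v hv => hg.differentiableAt (isOpen_ball.mem_nhds (hclosed hv))) hder
      (mem_closedBall_self (by linarith)) hz
    refine h1.trans ?_
    have h2 : ‖z - c‖ ≤ r / 2 := mem_closedBall_iff_norm.1 hz
    calc 256 / r * ‖z - c‖ ≤ 256 / r * (r / 2) := by gcongr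
      _ = 128 := by field_simp; norm_num
  have hFc : ‖2 * f c - 1‖ ≤ 2 * M + 1 := by
    refine (norm_sub_le _ _).trans ?_
    rw [norm_mul, two, norm_one]; linarith
  have hgz : ‖g z‖ ≤ K := by
    have h1 : g z = (g z - g c) + g c := by ring
    have h2 := norm_add_le (g z - g c) (g c)
    rw [← h1] at h2
    linarith
  have hpi : ∀ w : ℂ, ‖(Real.pi : ℂ) * w‖ = Real.pi * ‖w‖ := by
    intro w; rw [norm_mul, norm_real, Real.norm_of_nonneg Real.pi_pos.le]
  have hGz : ‖G z‖ ≤ Real.exp (Real.pi * K) := by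
    rw [← hgG z (hclosed hz)]
    refine (norm_cos_le_exp_norm _).trans (Real.exp_le_exp.2 ?_)
    rw [hpi]
    exact mul_le_mul_of_nonneg_left hgz Real.pi_pos.le
  have hFz : ‖2 * f z - 1‖ ≤ Real.exp (Real.pi * Real.exp (Real.pi * K)) := by
    rw [← hGf z (hclosed hz)]
    refine (norm_cos_le_exp_norm _).trans (Real.exp_le_exp.2 ?_)
    rw [hpi]
    exact mul_le_mul_of_nonneg_left hGz Real.pi_pos.le
  have h1 : (2 : ℂ) * f z = (2 * f z - 1) + 1 := by ring
  have h2 := norm_add_le (2 * f z - 1) 1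
  rw [← h1, norm_mul, two, norm_one] at h2
  linarith

/-! ### Functions with a zero only at the centre -/

/-- Holomorphic functions on a disc that omit `1` and vanish exactly at the centre are uniformly
bounded on a smaller disc. -/
theorem exists_bound_of_zero_only_at_center : ∃ C : ℝ, ∀ (k : ℂ → ℂ) (R : ℝ), 0 < R →
    DifferentiableOn ℂ k (ball 0 R) → k 0 = 0 → (∀ z ∈ ball 0 R, k z ≠ 1) →
    (∀ z ∈ ball 0 R, z ≠ 0 → k z ≠ 0) →
    ∀ z ∈ ball (0 : ℂ) (R * Real.exp (-(2 * Real.pi))), ‖k z‖ ≤ C := by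
  obtain ⟨C, hC⟩ := exists_bound_of_omits_zero_one 2
  refine ⟨C, fun k R hR hk hk0 hk1 hkz z hz => ?_⟩
  -- Under `w ↦ R exp w` the circle of radius `r` lifts to the line `Re w = -2π`, at distance `2π`
  -- from the edge of the half-plane `Re w < 0` that covers the punctured disc.
  set r := R * Real.exp (-(2 * Real.pi)) with hr
  have hr0 : 0 < r := mul_pos hR (Real.exp_pos _)
  have hrR : r < R := by
    have : Real.exp (-(2 * Real.pi)) < 1 := Real.exp_lt_one_iff.2 (by linarith [Real.pi_pos])
    rw [hr]; nlinarith
  have hsub : closedBall (0 : ℂ) r ⊆ ball 0 R := closedBall_subset_ball hrR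
  have hfront : frontier (ball (0 : ℂ) r) = sphere 0 r := frontier_ball 0 hr0.ne'
  have hclos : closure (ball (0 : ℂ) r) = closedBall 0 r := closure_ball 0 hr0.ne'
  -- Otherwise `|1/(k - 1)| < 1` on the whole circle, against the maximum principle, since `1/(k -
  -- 1)` has modulus 1 at 0. This gives `|k z₁| ≤ 2`, hence Schottky's theorem with bound 2.
  obtain ⟨z₁, hz₁, hkz₁⟩ : ∃ z₁ ∈ sphere (0 : ℂ) r, ‖k z₁ - 1‖ ≤ 1 := by
    by_contra! hcon
    obtain ⟨p, hp, hpmin⟩ := (isCompact_sphere (0 : ℂ) r).exists_isMinOn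
      (NormedSpace.sphere_nonempty.2 hr0.le)
      (f := fun z => ‖k z - 1‖)
      (((hk.continuousOn.mono (sphere_subset_closedBall.trans hsub)).sub continuousOn_const).norm)
    have hp1 := hcon p hp
    have h1 : ‖(k 0 - 1)⁻¹‖ ≤ ‖k p - 1‖⁻¹ := by
      refine norm_le_of_forall_mem_frontier_norm_le (U := ball (0 : ℂ) r)
        (f := fun z => (k z - 1)⁻¹) isBounded_ball ?_ (fun v hv => ?_)
        (subset_closure (mem_ball_self hr0))
      · refine DifferentiableOn.diffContOnCl ?_
        rw [hclos]
        exact ((hk.mono hsub).sub_const 1).inv (fun v hv => sub_ne_zero.2 (hk1 v (hsub hv)))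
      · rw [hfront] at hv
        rw [norm_inv]
        exact inv_anti₀ (by linarith) (hpmin hv)
    rw [hk0] at h1
    have h2 := inv_lt_one_of_one_lt₀ hp1
    simp at h1
    linarith
  have hexp : ∀ w : ℂ, w.re < 0 → (R : ℂ) * exp w ∈ ball (0 : ℂ) R ∧ (R : ℂ) * exp w ≠ 0 := by
    intro w hw
    refine ⟨?_, mul_ne_zero (by exact_mod_cast hR.ne') (exp_ne_zero _)⟩
    rw [mem_ball_zero_iff, norm_mul, norm_exp, norm_real, Real.norm_of_nonneg hR.le]
    have := Real.exp_lt_one_iff.2 hw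
    nlinarith
  have hRne : (R : ℂ) ≠ 0 := by exact_mod_cast hR.ne'
  have hz₁0 : z₁ ≠ 0 := by
    rintro rfl; simp at hz₁; exact hr0.ne hz₁
  set w₁ := log (z₁ / R) with hw₁
  have hw₁e : (R : ℂ) * exp w₁ = z₁ := by
    rw [hw₁, exp_log (div_ne_zero hz₁0 hRne)]; field_simp
  have hw₁re : w₁.re = -(2 * Real.pi) := by
    rw [hw₁, log_re, norm_div, mem_sphere_zero_iff_norm.1 hz₁, norm_real,
      Real.norm_of_nonneg hR.le, hr, mul_div_cancel_left₀ _ hR.ne', Real.log_exp]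
  have hhalf : ∀ w ∈ ball w₁ (2 * Real.pi), w.re < 0 := by
    intro w hw
    have h1 := (abs_le.1 (abs_re_le_norm (w - w₁))).2
    rw [mem_ball_iff_norm] at hw
    rw [sub_re, hw₁re] at h1
    linarith
  -- Every point of the circle has a logarithm within distance π of `w₁`, so Schottky's theorem on
  -- the disc of radius `2π` about `w₁` reaches the whole circle from its half disc.
  have hbd : ∀ v ∈ sphere (0 : ℂ) r, ‖k v‖ ≤ C := by
    intro v hv
    have hv0 : v ≠ 0 := by
      rintro rfl; simp at hv; exact hr0.ne hv
    set w := w₁ + log (v / z₁) with hw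
    have hwe : (R : ℂ) * exp w = v := by
      rw [hw, exp_add, exp_log (div_ne_zero hv0 hz₁0), ← mul_assoc, hw₁e]
      field_simp
    rw [← hwe]
    refine hC (fun w => k (R * exp w)) w₁ (2 * Real.pi) (by positivity)
      (hk.comp ((differentiable_exp.const_mul _).differentiableOn)
        (fun w hw => (hexp w (hhalf w hw)).1)) (fun w hw => ?_) ?_ w ?_
    · obtain ⟨h1, h2⟩ := hexp w (hhalf w hw)
      exact ⟨hkz _ h1 h2, hk1 _ h1⟩
    · simp only [hw₁e]
      have h1 : k z₁ = (k z₁ - 1) + 1 := by ring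
      rw [h1]
      refine (norm_add_le _ _).trans ?_
      rw [norm_one]; linarith
    · rw [mem_closedBall_iff_norm, hw, add_sub_cancel_left]
      have h1 : (log (v / z₁)).re = 0 := by
        rw [log_re, norm_div, mem_sphere_zero_iff_norm.1 hv, mem_sphere_zero_iff_norm.1 hz₁,
          div_self hr0.ne', Real.log_one]
      have h2 := norm_le_abs_re_add_abs_im (log (v / z₁))
      rw [h1, abs_zero, zero_add, log_im] at h2
      have := abs_arg_le_pi (v / z₁)
      linarith
  refine norm_le_of_forall_mem_frontier_norm_le (U := ball (0 : ℂ) r) isBounded_ball ?_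
    (fun v hv => hbd v (hfront ▸ hv)) (subset_closure hz)
  refine DifferentiableOn.diffContOnCl ?_
  rw [hclos]
  exact hk.mono hsub

/-! ### Montel's theorem for bounded functions -/

open scoped Classical in
/-- **Montel's theorem** for a uniformly bounded sequence of holomorphic functions on a disc. -/
theorem exists_subseq_tendstoUniformlyOn {x : ℕ → ℂ → ℂ} {r M : ℝ} (hr : 0 < r)
    (hd : ∀ n, DifferentiableOn ℂ (x n) (ball 0 r)) (hM : ∀ n, ∀ z ∈ ball 0 r, ‖x n z‖ ≤ M) :
    ∃ φ : ℕ → ℕ, StrictMono φ ∧ ∃ g : ℂ → ℂ, DifferentiableOn ℂ g (ball 0 (r / 2)) ∧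
      TendstoUniformlyOn (fun n => x (φ n)) g atTop (ball 0 (r / 2)) := by
  have hsub : closedBall (0 : ℂ) (r / 2) ⊆ ball 0 r := closedBall_subset_ball (by linarith)
  have hM0 : 0 ≤ M := (norm_nonneg _).trans (hM 0 0 (mem_ball_self hr))
  let K := closedBall (0 : ℂ) (r / 2)
  have : CompactSpace K := isCompact_iff_compactSpace.1 (isCompact_closedBall _ _)
  have hc : ∀ n, Continuous (K.domRestrict (x n)) := fun n =>
    ((hd n).continuousOn.mono hsub).domRestrict
  let X : ℕ → BoundedContinuousFunction K ℂ := fun n =>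
    BoundedContinuousFunction.mkOfCompact ⟨K.domRestrict (x n), hc n⟩
  -- A derivative bound from discs of radius `r / 2` gives a common Lipschitz constant, hence the
  -- equicontinuity for Arzelà–Ascoli.
  have hlip : ∀ n, ∀ z ∈ K, ∀ w ∈ K, dist (x n z) (x n w) ≤ 2 * M / (r / 2) * dist z w := by
    intro n z hz w hw
    have hder : ∀ v ∈ K, ‖deriv (x n) v‖ ≤ 2 * M / (r / 2) := by
      intro v hv
      have hsv : ball v (r / 2) ⊆ ball 0 r :=
        ball_subset_ball' (by have := mem_closedBall.1 hv; linarith)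
      refine norm_deriv_le_div_of_mapsTo_ball (R₂ := 2 * M) ((hd n).mono hsv) (fun u hu => ?_)
        (half_pos hr)
      rw [mem_closedBall, dist_eq_norm]
      have h1 := norm_sub_le (x n u) (x n v)
      have h2 := hM n u (hsv hu)
      have h3 := hM n v (hsub hv)
      linarith
    rw [dist_eq_norm, dist_eq_norm]
    exact (convex_closedBall (0 : ℂ) (r / 2)).norm_image_sub_le_of_norm_deriv_le
      (fun v hv => (hd n).differentiableAt (isOpen_ball.mem_nhds (hsub hv))) hder hw hz
  have hcomp : IsCompact (closure (range X)) := by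
    refine BoundedContinuousFunction.arzela_ascoli (closedBall (0 : ℂ) M) (isCompact_closedBall _ _)
      _ ?_ ?_
    · rintro _ z ⟨n, rfl⟩
      exact mem_closedBall_zero_iff.2 (hM n z (hsub z.2))
    · refine Metric.equicontinuous_of_continuity_modulus (fun t => 2 * M / (r / 2) * t) ?_ _ ?_
      · have : Continuous (fun t : ℝ => 2 * M / (r / 2) * t) := by fun_prop
        simpa using this.tendsto 0
      · rintro z w ⟨_, n, rfl⟩
        exact hlip n z z.2 w w.2
  obtain ⟨G, -, φ, hφ, hG⟩ := hcomp.tendsto_subseq (fun n => subset_closure (mem_range_self n))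
  refine ⟨φ, hφ, fun z => if h : z ∈ K then G ⟨z, h⟩ else 0, ?_⟩
  have hunif : TendstoUniformlyOn (fun n => x (φ n))
      (fun z => if h : z ∈ K then G ⟨z, h⟩ else 0) atTop K := by
    rw [BoundedContinuousFunction.tendsto_iff_tendstoUniformly,
      Metric.tendstoUniformly_iff] at hG
    rw [Metric.tendstoUniformlyOn_iff]
    intro δ hδ
    filter_upwards [hG δ hδ] with n hn z hz
    rw [dif_pos hz]
    exact hn ⟨z, hz⟩
  have hunif' := hunif.mono (ball_subset_closedBall (x := (0 : ℂ)) (ε := r / 2))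
  exact ⟨hunif'.tendstoLocallyUniformlyOn.differentiableOn
    (Eventually.of_forall fun n => (hd (φ n)).mono (ball_subset_closedBall.trans hsub))
    isOpen_ball, hunif'⟩

/-! ### Homogeneous coordinates and the chordal distance -/

/-- The point of the sphere with homogeneous coordinates `[x : y]`. -/
noncomputable def proj (x y : ℂ) : Sphere := if y = 0 then ∞ else ((x / y : ℂ) : Sphere)

/-- The first homogeneous coordinate of a point of the sphere. -/
def liftX : Sphere → ℂ
  | ∞ => 1
  | (z : ℂ) => z

/-- The second homogeneous coordinate of a point of the sphere. -/
def liftY : Sphere → ℂ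
  | ∞ => 0
  | (_ : ℂ) => 1

@[simp] theorem liftX_infty : liftX ∞ = 1 := rfl
@[simp] theorem liftY_infty : liftY ∞ = 0 := rfl
@[simp] theorem liftX_coe (z : ℂ) : liftX (z : Sphere) = z := rfl
@[simp] theorem liftY_coe (z : ℂ) : liftY (z : Sphere) = 1 := rfl
@[simp] theorem finiteCoord_coe (z : ℂ) : finiteCoord (z : Sphere) = z := rfl
@[simp] theorem finiteCoord_infty : finiteCoord ∞ = 0 := rfl
@[simp] theorem inversion_infty : inversion ∞ = ((0 : ℂ) : Sphere) := rfl
theorem inversion_coe (z : ℂ) :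
    inversion (z : Sphere) = if z = 0 then ∞ else ((z⁻¹ : ℂ) : Sphere) := rfl

theorem proj_zero_right (x : ℂ) : proj x 0 = ∞ := if_pos rfl

theorem proj_of_ne {x y : ℂ} (h : y ≠ 0) : proj x y = ((x / y : ℂ) : Sphere) := if_neg h

@[simp] theorem proj_one_right (x : ℂ) : proj x 1 = (x : Sphere) := by
  rw [proj_of_ne one_ne_zero, div_one]

theorem proj_lift (p : Sphere) : proj (liftX p) (liftY p) = p := by
  induction p using OnePoint.rec <;> simp [proj_zero_right]

theorem lift_ne_zero (p : Sphere) : liftX p ≠ 0 ∨ liftY p ≠ 0 := by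
  induction p using OnePoint.rec <;> simp

theorem proj_eq_proj_iff {x y u v : ℂ} (h : x ≠ 0 ∨ y ≠ 0) (h' : u ≠ 0 ∨ v ≠ 0) :
    proj x y = proj u v ↔ x * v = u * y := by
  by_cases hy : y = 0
  · subst hy
    have hx : x ≠ 0 := by simpa using h
    by_cases hv : v = 0
    · simp [hv, proj_zero_right]
    · simp [proj_zero_right, proj_of_ne hv, hv, hx]
  · by_cases hv : v = 0
    · subst hv
      have hu : u ≠ 0 := by simpa using h'
      simp [proj_zero_right, proj_of_ne hy, hy, hu]
    · rw [proj_of_ne hy, proj_of_ne hv, OnePoint.coe_eq_coe, div_eq_div_iff hy hv]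

theorem proj_eq_infty_iff {x y : ℂ} : proj x y = ∞ ↔ y = 0 := by
  by_cases hy : y = 0 <;> simp [proj, hy]

/-- The lift of `[x : y]` is proportional to `(x, y)`. -/
theorem exists_lift_proj {x y : ℂ} (h : x ≠ 0 ∨ y ≠ 0) :
    ∃ t : ℂ, t ≠ 0 ∧ x = t * liftX (proj x y) ∧ y = t * liftY (proj x y) := by
  by_cases hy : y = 0
  · subst hy
    exact ⟨x, by simpa using h, by simp [proj_zero_right]⟩
  · exact ⟨y, hy, by rw [proj_of_ne hy]; simp; field_simp⟩

/-- Half the chordal distance. -/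
noncomputable def chord (p q : Sphere) : ℝ :=
  ‖liftX p * liftY q - liftX q * liftY p‖ /
    (√(‖liftX p‖ ^ 2 + ‖liftY p‖ ^ 2) * √(‖liftX q‖ ^ 2 + ‖liftY q‖ ^ 2))

theorem sphericalDist_eq (p q : Sphere) : sphericalDist p q = 2 * Real.arcsin (chord p q) := by
  induction p using OnePoint.rec <;> induction q using OnePoint.rec <;>
    simp [sphericalDist, chord, add_comm]

/-- Numerator and denominator scale by the same factor, so any homogeneous coordinates, not just the
normalised lifts, compute `chord`. -/
theorem chord_proj {x y u v : ℂ} (h : x ≠ 0 ∨ y ≠ 0) (h' : u ≠ 0 ∨ v ≠ 0) :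
    chord (proj x y) (proj u v) =
      ‖x * v - u * y‖ / (√(‖x‖ ^ 2 + ‖y‖ ^ 2) * √(‖u‖ ^ 2 + ‖v‖ ^ 2)) := by
  obtain ⟨t, ht, hx, hy⟩ := exists_lift_proj h
  obtain ⟨s, hs, hu, hv⟩ := exists_lift_proj h'
  set p := proj x y
  set q := proj u v
  have e1 : x * v - u * y = t * s * (liftX p * liftY q - liftX q * liftY p) := by
    rw [hx, hy, hu, hv]; ring
  have e2 : √(‖x‖ ^ 2 + ‖y‖ ^ 2) = ‖t‖ * √(‖liftX p‖ ^ 2 + ‖liftY p‖ ^ 2) := by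
    rw [hx, hy, norm_mul, norm_mul, mul_pow, mul_pow, ← mul_add,
      Real.sqrt_mul (sq_nonneg _), Real.sqrt_sq (norm_nonneg _)]
  have e3 : √(‖u‖ ^ 2 + ‖v‖ ^ 2) = ‖s‖ * √(‖liftX q‖ ^ 2 + ‖liftY q‖ ^ 2) := by
    rw [hu, hv, norm_mul, norm_mul, mul_pow, mul_pow, ← mul_add,
      Real.sqrt_mul (sq_nonneg _), Real.sqrt_sq (norm_nonneg _)]
  have ht' := norm_ne_zero_iff.2 ht
  have hs' := norm_ne_zero_iff.2 hs
  rw [e1, e2, e3, norm_mul, norm_mul, chord, show ‖t‖ * √(‖liftX p‖ ^ 2 + ‖liftY p‖ ^ 2) *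
    (‖s‖ * √(‖liftX q‖ ^ 2 + ‖liftY q‖ ^ 2)) = ‖t‖ * ‖s‖ * (√(‖liftX p‖ ^ 2 + ‖liftY p‖ ^ 2) *
      √(‖liftX q‖ ^ 2 + ‖liftY q‖ ^ 2)) by ring, mul_div_mul_left _ _ (mul_ne_zero ht' hs')]

theorem norm_le_sqrt_left (x y : ℂ) : ‖x‖ ≤ √(‖x‖ ^ 2 + ‖y‖ ^ 2) :=
  Real.le_sqrt_of_sq_le (by nlinarith [sq_nonneg ‖y‖])

theorem norm_le_sqrt_right (x y : ℂ) : ‖y‖ ≤ √(‖x‖ ^ 2 + ‖y‖ ^ 2) :=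
  Real.le_sqrt_of_sq_le (by nlinarith [sq_nonneg ‖x‖])

theorem chord_nonneg (p q : Sphere) : 0 ≤ chord p q := by unfold chord; positivity

theorem ne_zero_of_le_max {x y : ℂ} {c : ℝ} (hc : 0 < c) (h : c ≤ max ‖x‖ ‖y‖) :
    x ≠ 0 ∨ y ≠ 0 := by
  by_contra! h0
  rw [h0.1, h0.2] at h
  simp at h
  linarith

theorem arcsin_le_pi_div_two_mul {t : ℝ} (ht : 0 ≤ t) : Real.arcsin t ≤ Real.pi / 2 * t := by
  have hpi := Real.pi_pos
  rcases le_total t 1 with h1 | h1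
  · have h2 := Real.mul_le_sin (Real.arcsin_nonneg.2 ht) (Real.arcsin_le_pi_div_two t)
    rw [Real.sin_arcsin (by linarith) h1] at h2
    calc Real.arcsin t = Real.pi / 2 * (2 / Real.pi * Real.arcsin t) := by field_simp
      _ ≤ Real.pi / 2 * t := by gcongr
  · exact (Real.arcsin_le_pi_div_two t).trans (by nlinarith)

theorem sphericalDist_le (p q : Sphere) : sphericalDist p q ≤ Real.pi * chord p q := by
  rw [sphericalDist_eq]
  linarith [arcsin_le_pi_div_two_mul (chord_nonneg p q)]

theorem le_max_sqrt {x y : ℂ} {c : ℝ} (h : c ≤ max ‖x‖ ‖y‖) : c ≤ √(‖x‖ ^ 2 + ‖y‖ ^ 2) :=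
  h.trans (max_le (norm_le_sqrt_left x y) (norm_le_sqrt_right x y))

theorem sphericalDist_proj_le {x y u v : ℂ} {c : ℝ} (hc : 0 < c) (h : c ≤ max ‖x‖ ‖y‖)
    (h' : c ≤ max ‖u‖ ‖v‖) :
    sphericalDist (proj x y) (proj u v) ≤ Real.pi * (‖x * v - u * y‖ / (c * c)) := by
  refine (sphericalDist_le _ _).trans ?_
  rw [chord_proj (ne_zero_of_le_max hc h) (ne_zero_of_le_max hc h')]
  have := Real.pi_pos
  gcongr
  · exact le_max_sqrt h
  · exact le_max_sqrt h'

/-! ### Continuity and holomorphy in homogeneous coordinates -/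

theorem tendsto_inversion_coe_zero :
    Tendsto (fun w : ℂ => inversion (w : Sphere)) (𝓝 0) (𝓝 ∞) := by
  rw [← nhdsNE_sup_pure (0 : ℂ), tendsto_sup]
  constructor
  · have h1 : Tendsto (fun w : ℂ => ((w⁻¹ : ℂ) : Sphere)) (𝓝[≠] 0) (𝓝 ∞) := by
      refine OnePoint.tendsto_coe_infty.comp ?_
      rw [coclosedCompact_eq_cocompact, ← Metric.cobounded_eq_cocompact]
      exact tendsto_inv₀_nhdsNE_zero
    refine h1.congr' ?_
    filter_upwards [self_mem_nhdsWithin] with w hw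
    rw [inversion_coe, if_neg (show w ≠ 0 from hw)]
  · rw [tendsto_pure_left]
    intro s hs
    simpa [inversion_coe] using mem_of_mem_nhds hs

theorem proj_eq_inversion {x y : ℂ} (hx : x ≠ 0) : proj x y = inversion ((y / x : ℂ) : Sphere) := by
  by_cases hy : y = 0
  · simp [hy, proj_zero_right, inversion_coe]
  · rw [proj_of_ne hy, inversion_coe, if_neg (div_ne_zero hy hx), inv_div]

theorem finiteCoord_inversion_proj {x y : ℂ} (hx : x ≠ 0) :
    finiteCoord (inversion (proj x y)) = y / x := by
  by_cases hy : y = 0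
  · simp [hy, proj_zero_right]
  · rw [proj_of_ne hy, inversion_coe, if_neg (div_ne_zero hx hy), inv_div, finiteCoord_coe]

theorem tendsto_proj {α : Type*} {l : Filter α} {x y : α → ℂ} {u v : ℂ}
    (hx : Tendsto x l (𝓝 u)) (hy : Tendsto y l (𝓝 v)) (h : u ≠ 0 ∨ v ≠ 0) :
    Tendsto (fun i => proj (x i) (y i)) l (𝓝 (proj u v)) := by
  by_cases hv : v = 0
  · have hu : u ≠ 0 := by simpa [hv] using h
    have h1 := hy.div hx hu
    rw [hv, zero_div] at h1
    rw [hv, proj_zero_right]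
    refine (tendsto_inversion_coe_zero.comp h1).congr' ?_
    filter_upwards [hx.eventually_ne hu] with i hi
    rw [proj_eq_inversion hi]
    rfl
  · rw [proj_of_ne hv]
    refine ((OnePoint.continuous_coe.tendsto _).comp (hx.div hy hv)).congr' ?_
    filter_upwards [hy.eventually_ne hv] with i hi
    rw [proj_of_ne hi]
    rfl

theorem finiteCoord_proj {x y : ℂ} (hy : y ≠ 0) : finiteCoord (proj x y) = x / y := by
  rw [proj_of_ne hy, finiteCoord_coe]

/-- Together with the converse `HolomorphicAtFinite.exists_proj`, this removes the distinction
between finite values and poles: holomorphy means having analytic coordinates without common zero.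
-/
theorem holomorphicAtFinite_of_proj {f : ℂ → Sphere} {z : ℂ} {x y : ℂ → ℂ}
    (hx : AnalyticAt ℂ x z) (hy : AnalyticAt ℂ y z) (h0 : x z ≠ 0 ∨ y z ≠ 0)
    (h : f =ᶠ[𝓝 z] fun w => proj (x w) (y w)) : HolomorphicAtFinite f z := by
  refine ⟨?_, fun hfz => ?_, fun hfz => ?_⟩
  · rw [ContinuousAt, h.eq_of_nhds]
    exact (tendsto_proj hx.continuousAt hy.continuousAt h0).congr' h.symm
  · rw [h.eq_of_nhds, Ne, proj_eq_infty_iff] at hfz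
    refine (hx.div hy hfz).congr ?_
    filter_upwards [h, hy.continuousAt.eventually_ne hfz] with w hw hyw
    rw [hw, finiteCoord_proj hyw]
    rfl
  · rw [h.eq_of_nhds, proj_eq_infty_iff] at hfz
    have hxz : x z ≠ 0 := by simpa [hfz] using h0
    refine (hy.div hx hxz).congr ?_
    filter_upwards [h, hx.continuousAt.eventually_ne hxz] with w hw hxw
    rw [hw, finiteCoord_inversion_proj hxw]
    rfl

theorem HolomorphicAtFinite.exists_proj {f : ℂ → Sphere} {z : ℂ} (hf : HolomorphicAtFinite f z) :
    ∃ x y : ℂ → ℂ, AnalyticAt ℂ x z ∧ AnalyticAt ℂ y z ∧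
      ∀ᶠ w in 𝓝 z, (x w ≠ 0 ∨ y w ≠ 0) ∧ f w = proj (x w) (y w) := by
  obtain ⟨hc, h1, h2⟩ := hf
  by_cases hz : f z = ∞
  · refine ⟨fun _ => 1, _, analyticAt_const, h2 hz, ?_⟩
    have hne : ∀ᶠ w in 𝓝 z, f w ≠ ((0 : ℂ) : Sphere) :=
      hc.eventually_ne (by rw [hz]; exact OnePoint.infty_ne_coe _)
    filter_upwards [hne] with w hw
    refine ⟨Or.inl one_ne_zero, ?_⟩
    generalize f w = p at hw ⊢
    induction p using OnePoint.rec with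
    | infty => simp [proj_zero_right]
    | coe a =>
      have ha : a ≠ 0 := by simpa using hw
      rw [inversion_coe, if_neg ha, finiteCoord_coe, proj_of_ne (inv_ne_zero ha)]
      simp
  · refine ⟨_, fun _ => 1, h1 hz, analyticAt_const, ?_⟩
    filter_upwards [hc.eventually_ne hz] with w hw
    refine ⟨Or.inr one_ne_zero, ?_⟩
    generalize f w = p at hw ⊢
    induction p using OnePoint.rec with
    | infty => exact absurd rfl hw
    | coe a => simp

/-! ### Bounded lifts of maps that stay apart -/

/-- On the disc of radius `r` about `0`, the function `f` has holomorphic homogeneous coordinates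
that are bounded by `M` and never both smaller than `c`. -/
def BoundedLift (f : ℂ → Sphere) (r M c : ℝ) : Prop :=
  ∃ x y : ℂ → ℂ, DifferentiableOn ℂ x (ball 0 r) ∧ DifferentiableOn ℂ y (ball 0 r) ∧
    ∀ z ∈ ball (0 : ℂ) r, ‖x z‖ ≤ M ∧ ‖y z‖ ≤ M ∧ c ≤ max ‖x z‖ ‖y z‖ ∧ f z = proj (x z) (y z)

theorem BoundedLift.mono {f : ℂ → Sphere} {r M c r' M' c' : ℝ} (h : BoundedLift f r M c)
    (hr : r' ≤ r) (hM : M ≤ M') (hc : c' ≤ c) : BoundedLift f r' M' c' := by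
  obtain ⟨x, y, hx, hy, h⟩ := h
  have hs : ball (0 : ℂ) r' ⊆ ball 0 r := ball_subset_ball hr
  refine ⟨x, y, hx.mono hs, hy.mono hs, fun z hz => ?_⟩
  obtain ⟨h1, h2, h3, h4⟩ := h z (hs hz)
  exact ⟨h1.trans hM, h2.trans hM, hc.trans h3, h4⟩

theorem proj_mul_left {t : ℂ} (ht : t ≠ 0) (x y : ℂ) : proj (t * x) (t * y) = proj x y := by
  by_cases hy : y = 0
  · simp [hy, proj_zero_right]
  · rw [proj_of_ne hy, proj_of_ne (mul_ne_zero ht hy), mul_div_mul_left _ _ ht]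

theorem lift_det_eq_zero_iff {p q : Sphere} :
    liftX p * liftY q - liftX q * liftY p = 0 ↔ p = q := by
  rw [sub_eq_zero, ← proj_eq_proj_iff (lift_ne_zero p) (lift_ne_zero q), proj_lift, proj_lift]

/-- The quotients of products of homogeneous coordinates of two points by their determinant do not
depend on the choice of the coordinates. -/
theorem lift_mul_lift_div_det {x y u v : ℂ} (h : x ≠ 0 ∨ y ≠ 0) (h' : u ≠ 0 ∨ v ≠ 0) {d : ℂ}
    (hd : d = liftX (proj x y) * liftY (proj u v) - liftX (proj u v) * liftY (proj x y)) :
    liftX (proj x y) * liftX (proj u v) / d = x * u / (x * v - u * y) ∧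
    liftX (proj x y) * liftY (proj u v) / d = x * v / (x * v - u * y) ∧
    liftY (proj x y) * liftX (proj u v) / d = y * u / (x * v - u * y) ∧
    liftY (proj x y) * liftY (proj u v) / d = y * v / (x * v - u * y) := by
  obtain ⟨t, ht, hx, hy⟩ := exists_lift_proj h
  obtain ⟨s, hs, hu, hv⟩ := exists_lift_proj h'
  generalize proj x y = p at *
  generalize proj u v = q at *
  subst hx hy hu hv hd
  have e : ∀ a b c d : ℂ, t * a * (s * b) - s * c * (t * d) = t * s * (a * b - c * d) := by
    intros; ring
  have e' : ∀ a b : ℂ, t * a * (s * b) = t * s * (a * b) := by intros; ring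
  have hts := mul_ne_zero ht hs
  simp only [e]
  simp only [e', mul_div_mul_left _ _ hts, and_self]

/-- `liftX` and `liftY` are not continuous at poles, but these quotients are independent of scaling
and may be computed with local analytic coordinates. Up to sign they are the entries of the
projection of ℂ² onto the line `a` along the line `b`. -/
theorem analyticAt_lift_mul_lift_div_det {a b : ℂ → Sphere} {z : ℂ}
    (ha : HolomorphicAtFinite a z) (hb : HolomorphicAtFinite b z) (hab : a z ≠ b z) :
    let d := fun w => liftX (a w) * liftY (b w) - liftX (b w) * liftY (a w)
    AnalyticAt ℂ (fun w => liftX (a w) * liftX (b w) / d w) z ∧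
    AnalyticAt ℂ (fun w => liftX (a w) * liftY (b w) / d w) z ∧
    AnalyticAt ℂ (fun w => liftY (a w) * liftX (b w) / d w) z ∧
    AnalyticAt ℂ (fun w => liftY (a w) * liftY (b w) / d w) z := by
  intro d
  obtain ⟨x, y, hx, hy, hxy⟩ := ha.exists_proj
  obtain ⟨u, v, hu, hv, huv⟩ := hb.exists_proj
  have hD : AnalyticAt ℂ (fun w => x w * v w - u w * y w) z := (hx.mul hv).sub (hu.mul hy)
  have hD0 : x z * v z - u z * y z ≠ 0 := by
    obtain ⟨h1, h2⟩ := hxy.self_of_nhds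
    obtain ⟨h3, h4⟩ := huv.self_of_nhds
    rw [h2, h4, Ne, proj_eq_proj_iff h1 h3] at hab
    exact sub_ne_zero.2 hab
  have key : ∀ᶠ w in 𝓝 z,
      liftX (a w) * liftX (b w) / d w = x w * u w / (x w * v w - u w * y w) ∧
      liftX (a w) * liftY (b w) / d w = x w * v w / (x w * v w - u w * y w) ∧
      liftY (a w) * liftX (b w) / d w = y w * u w / (x w * v w - u w * y w) ∧
      liftY (a w) * liftY (b w) / d w = y w * v w / (x w * v w - u w * y w) := by
    filter_upwards [hxy, huv] with w h1 h2
    have := lift_mul_lift_div_det h1.1 h2.1 rfl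
    rw [← h1.2, ← h2.2] at this
    exact this
  refine ⟨((hx.mul hu).div hD hD0).congr ?_, ((hx.mul hv).div hD hD0).congr ?_,
    ((hy.mul hu).div hD hD0).congr ?_, ((hy.mul hv).div hD hD0).congr ?_⟩
  · filter_upwards [key] with w hw using hw.1.symm
  · filter_upwards [key] with w hw using hw.2.1.symm
  · filter_upwards [key] with w hw using hw.2.2.1.symm
  · filter_upwards [key] with w hw using hw.2.2.2.symm

/-- A holomorphic map to the sphere that stays away from another one has a bounded lift, with
constants depending only on the separation. -/
theorem boundedLift_of_le_chord {a b : ℂ → Sphere} {R κ : ℝ} (hR : 0 < R) (hκ : 0 < κ)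
    (hκ1 : κ ≤ 1) (ha : ∀ z ∈ ball (0 : ℂ) R, HolomorphicAtFinite a z)
    (hb : ∀ z ∈ ball (0 : ℂ) R, HolomorphicAtFinite b z)
    (hsep : ∀ z ∈ ball (0 : ℂ) R, κ ≤ chord (a z) (b z)) :
    BoundedLift a (κ * R / 8) (1 / κ) (1 / 4) := by
  set d := fun w => liftX (a w) * liftY (b w) - liftX (b w) * liftY (a w) with hd
  have hne : ∀ z ∈ ball (0 : ℂ) R, a z ≠ b z := by
    intro z hz h
    have h1 := hsep z hz
    rw [h] at h1
    simp only [chord, sub_self, norm_zero, zero_div] at h1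
    linarith
  have hd0 : ∀ z ∈ ball (0 : ℂ) R, d z ≠ 0 := fun z hz h =>
    hne z hz (lift_det_eq_zero_iff.1 h)
  have hdiff := fun z (hz : z ∈ ball (0 : ℂ) R) =>
    analyticAt_lift_mul_lift_div_det (ha z hz) (hb z hz) (hne z hz)
  -- Each entry of the projection is at most `|a| |b| / |d|`, the reciprocal of the chordal
  -- distance.
  have hbound : ∀ z ∈ ball (0 : ℂ) R, ∀ s t : ℂ, (s = liftX (a z) ∨ s = liftY (a z)) →
      (t = liftX (b z) ∨ t = liftY (b z)) → ‖s * t / d z‖ ≤ 1 / κ := by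
    intro z hz s t hs ht
    have hs' : ‖s‖ ≤ √(‖liftX (a z)‖ ^ 2 + ‖liftY (a z)‖ ^ 2) := by
      rcases hs with rfl | rfl
      exacts [norm_le_sqrt_left _ _, norm_le_sqrt_right _ _]
    have ht' : ‖t‖ ≤ √(‖liftX (b z)‖ ^ 2 + ‖liftY (b z)‖ ^ 2) := by
      rcases ht with rfl | rfl
      exacts [norm_le_sqrt_left _ _, norm_le_sqrt_right _ _]
    have h1 := hsep z hz
    have hdz : 0 < ‖d z‖ := norm_pos_iff.2 (hd0 z hz)
    have hst := mul_le_mul hs' ht' (norm_nonneg _) (Real.sqrt_nonneg _)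
    set Q := √(‖liftX (a z)‖ ^ 2 + ‖liftY (a z)‖ ^ 2) *
      √(‖liftX (b z)‖ ^ 2 + ‖liftY (b z)‖ ^ 2) with hQ
    have hQ0 : 0 < Q := by
      rcases (show 0 ≤ Q by positivity).lt_or_eq with h | h
      · exact h
      · rw [chord, ← hQ, ← h, div_zero] at h1; linarith
    rw [chord, ← hQ, le_div_iff₀ hQ0] at h1
    rw [norm_div, norm_mul, div_le_div_iff₀ hdz hκ, one_mul]
    calc ‖s‖ * ‖t‖ * κ ≤ Q * κ := by gcongr
      _ = κ * Q := mul_comm _ _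
      _ ≤ ‖d z‖ := h1
  have hr : κ * R / 8 ≤ R := by nlinarith
  have hs : ball (0 : ℂ) (κ * R / 8) ⊆ ball 0 R := ball_subset_ball hr
  have hdiffOn : ∀ {g : ℂ → ℂ}, (∀ z ∈ ball (0 : ℂ) R, AnalyticAt ℂ g z) →
      DifferentiableOn ℂ g (ball 0 R) := fun h z hz =>
    (h z hz).differentiableAt.differentiableWithinAt
  have hosc : ∀ g : ℂ → ℂ, DifferentiableOn ℂ g (ball 0 R) →
      (∀ z ∈ ball (0 : ℂ) R, ‖g z‖ ≤ 1 / κ) → 1 / 2 ≤ ‖g 0‖ →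
      ∀ z ∈ ball (0 : ℂ) (κ * R / 8), 1 / 4 ≤ ‖g z‖ := by
    intro g hg hgb hg0 z hz
    have h0 : (0 : ℂ) ∈ ball (0 : ℂ) R := mem_ball_self hR
    have h1 := dist_le_div_mul_dist_of_mapsTo_ball (R₂ := 1 / κ + 1 / κ) hg (fun w hw => by
      rw [mem_closedBall, dist_eq_norm]
      exact (norm_sub_le _ _).trans (add_le_add (hgb w hw) (hgb 0 h0))) (hs hz)
    have h2 : dist z 0 ≤ κ * R / 8 := (mem_ball.1 hz).le
    have h3 : (1 / κ + 1 / κ) / R * dist z 0 ≤ 1 / 4 := by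
      calc (1 / κ + 1 / κ) / R * dist z 0 ≤ (1 / κ + 1 / κ) / R * (κ * R / 8) := by gcongr
        _ = 1 / 4 := by field_simp; norm_num
    rw [dist_comm, dist_eq_norm] at h1
    have h4 := norm_sub_norm_le (g 0) (g z)
    linarith
  -- The projection has trace 1, so one diagonal entry is at least 1/2 in modulus at 0. By `hosc` it
  -- stays at least 1/4 on the smaller disc, and the column containing it is the required lift of
  -- `a`.
  have h1 : ∀ z ∈ ball (0 : ℂ) R,
      liftX (a z) * liftY (b z) / d z - liftY (a z) * liftX (b z) / d z = 1 := by
    intro z hz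
    rw [← sub_div, div_eq_one_iff_eq (hd0 z hz), hd]
    ring
  have hhalf : 1 / 2 ≤ ‖liftX (a 0) * liftY (b 0) / d 0‖ ∨
      1 / 2 ≤ ‖liftY (a 0) * liftX (b 0) / d 0‖ := by
    by_contra! hcon
    have h2 := norm_sub_le (liftX (a 0) * liftY (b 0) / d 0) (liftY (a 0) * liftX (b 0) / d 0)
    rw [h1 0 (mem_ball_self hR), norm_one] at h2
    linarith
  have hproj : ∀ z (t : ℂ), liftX (a z) * t / d z ≠ 0 ∨ liftY (a z) * t / d z ≠ 0 →
      a z = proj (liftX (a z) * t / d z) (liftY (a z) * t / d z) := by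
    intro z t h
    have ht : t / d z ≠ 0 := by
      intro h0
      simp [mul_div_assoc, h0] at h
    rw [mul_div_assoc, mul_div_assoc, mul_comm, mul_comm (liftY (a z)), proj_mul_left ht,
      proj_lift]
  rcases hhalf with h | h
  · refine ⟨fun z => liftX (a z) * liftY (b z) / d z, fun z => liftY (a z) * liftY (b z) / d z,
      (hdiffOn fun z hz => (hdiff z hz).2.1).mono hs,
      (hdiffOn fun z hz => (hdiff z hz).2.2.2).mono hs, fun z hz => ?_⟩
    have h2 := hosc _ (hdiffOn fun z hz => (hdiff z hz).2.1)
      (fun z hz => hbound z hz _ _ (Or.inl rfl) (Or.inr rfl)) h z hz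
    refine ⟨hbound z (hs hz) _ _ (Or.inl rfl) (Or.inr rfl),
      hbound z (hs hz) _ _ (Or.inr rfl) (Or.inr rfl), h2.trans (le_max_left _ _), ?_⟩
    exact hproj z _ (ne_zero_of_le_max (by norm_num) (h2.trans (le_max_left _ _)))
  · refine ⟨fun z => liftX (a z) * liftX (b z) / d z, fun z => liftY (a z) * liftX (b z) / d z,
      (hdiffOn fun z hz => (hdiff z hz).1).mono hs,
      (hdiffOn fun z hz => (hdiff z hz).2.2.1).mono hs, fun z hz => ?_⟩
    have h2 := hosc _ (hdiffOn fun z hz => (hdiff z hz).2.2.1)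
      (fun z hz => hbound z hz _ _ (Or.inr rfl) (Or.inl rfl)) h z hz
    refine ⟨hbound z (hs hz) _ _ (Or.inl rfl) (Or.inl rfl),
      hbound z (hs hz) _ _ (Or.inr rfl) (Or.inl rfl), h2.trans (le_max_right _ _), ?_⟩
    exact hproj z _ (ne_zero_of_le_max (by norm_num) (h2.trans (le_max_right _ _)))

/-! ### Maps sharing the values 0, 1, ∞ -/

theorem HolomorphicAtFinite.eventually_eq_or_eventually_ne {f : ℂ → Sphere} {z : ℂ}
    (hf : HolomorphicAtFinite f z) (p : Sphere) :
    (∀ᶠ w in 𝓝 z, f w = p) ∨ ∀ᶠ w in 𝓝[≠] z, f w ≠ p := by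
  obtain ⟨x, y, hx, hy, h⟩ := hf.exists_proj
  have han : AnalyticAt ℂ (fun w => x w * liftY p - liftX p * y w) z :=
    (hx.mul analyticAt_const).sub (analyticAt_const.mul hy)
  have key : ∀ᶠ w in 𝓝 z, f w = p ↔ x w * liftY p - liftX p * y w = 0 := by
    filter_upwards [h] with w hw
    conv_lhs => rw [hw.2, ← proj_lift p]
    rw [proj_eq_proj_iff hw.1 (lift_ne_zero p), sub_eq_zero]
  rcases han.eventually_eq_zero_or_eventually_ne_zero with h0 | h0
  · left
    filter_upwards [key, h0] with w h1 h2 using h1.2 h2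
  · right
    filter_upwards [key.filter_mono nhdsWithin_le_nhds, h0] with w h1 h2 using fun h => h2 (h1.1 h)

theorem HolomorphicAtFinite.differentiableAt_inversion {f : ℂ → Sphere} {z : ℂ}
    (hf : HolomorphicAtFinite f z) (h0 : f z ≠ ((0 : ℂ) : Sphere)) :
    DifferentiableAt ℂ (fun w => finiteCoord (inversion (f w))) z := by
  obtain ⟨x, y, hx, hy, h⟩ := hf.exists_proj
  have hxz : x z ≠ 0 := by
    intro hxz
    obtain ⟨h1, h2⟩ := h.self_of_nhds
    have h3 : y z ≠ 0 := by simpa [hxz] using h1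
    rw [h2, hxz, proj_of_ne h3, zero_div] at h0
    exact h0 rfl
  refine (hy.div hx hxz).differentiableAt.congr_of_eventuallyEq ?_
  filter_upwards [h, hx.continuousAt.eventually_ne hxz] with w hw hxw
  rw [hw.2, finiteCoord_inversion_proj hxw]
  rfl

theorem proj_finiteCoord_one {p : Sphere} (h : p ≠ ∞) : proj (finiteCoord p) 1 = p := by
  induction p using OnePoint.rec with
  | infty => exact absurd rfl h
  | coe a => simp

theorem proj_one_finiteCoord_inversion {p : Sphere} (h : p ≠ ((0 : ℂ) : Sphere)) :
    proj 1 (finiteCoord (inversion p)) = p := by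
  induction p using OnePoint.rec with
  | infty => simp [proj_zero_right]
  | coe a =>
    have ha : a ≠ 0 := by simpa using h
    rw [inversion_coe, if_neg ha, finiteCoord_coe, proj_of_ne (inv_ne_zero ha)]
    simp

theorem finiteCoord_eq_iff {p : Sphere} (h : p ≠ ∞) {a : ℂ} :
    finiteCoord p = a ↔ p = (a : Sphere) := by
  induction p using OnePoint.rec with
  | infty => exact absurd rfl h
  | coe b => simp

theorem finiteCoord_inversion_eq_zero_iff {p : Sphere} (h : p ≠ ((0 : ℂ) : Sphere)) :
    finiteCoord (inversion p) = 0 ↔ p = ∞ := by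
  induction p using OnePoint.rec with
  | infty => simp
  | coe b =>
    have hb : b ≠ 0 := by simpa using h
    simp [inversion_coe, hb]

theorem finiteCoord_inversion_eq_one_iff {p : Sphere} (h : p ≠ ((0 : ℂ) : Sphere)) :
    finiteCoord (inversion p) = 1 ↔ p = ((1 : ℂ) : Sphere) := by
  induction p using OnePoint.rec with
  | infty => simp
  | coe b =>
    have hb : b ≠ 0 := by simpa using h
    simp [inversion_coe, hb]

/-- Two sphere-valued functions take each of the values `0`, `1`, `∞` at the same points of `s`. -/
def ShareZeroOneInfty (f g : ℂ → Sphere) (s : Set ℂ) : Prop :=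
  ∀ z ∈ s, (f z = ((0 : ℂ) : Sphere) ↔ g z = ((0 : ℂ) : Sphere)) ∧
    (f z = ((1 : ℂ) : Sphere) ↔ g z = ((1 : ℂ) : Sphere)) ∧ (f z = ∞ ↔ g z = ∞)

theorem boundedLift_const {x y : ℂ} {f : ℂ → Sphere} {r : ℝ} (hx : ‖x‖ ≤ 1) (hy : ‖y‖ ≤ 1)
    (hxy : 1 ≤ max ‖x‖ ‖y‖) (h : ∀ z ∈ ball (0 : ℂ) r, f z = proj x y) : BoundedLift f r 1 1 :=
  ⟨fun _ => x, fun _ => y, differentiableOn_const _, differentiableOn_const _,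
    fun z hz => ⟨hx, hy, hxy, h z hz⟩⟩

theorem boundedLift_of_finite {k : ℂ → ℂ} {f : ℂ → Sphere} {r C : ℝ}
    (hk : DifferentiableOn ℂ k (ball 0 r)) (hC : ∀ z ∈ ball (0 : ℂ) r, ‖k z‖ ≤ C)
    (h : ∀ z ∈ ball (0 : ℂ) r, f z = proj (k z) 1) : BoundedLift f r (max C 1) 1 :=
  ⟨k, fun _ => 1, hk, differentiableOn_const _, fun z hz =>
    ⟨(hC z hz).trans (le_max_left _ _), by simp, by simp, h z hz⟩⟩

theorem boundedLift_of_ne_zero {k : ℂ → ℂ} {f : ℂ → Sphere} {r C : ℝ}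
    (hk : DifferentiableOn ℂ k (ball 0 r)) (hC : ∀ z ∈ ball (0 : ℂ) r, ‖k z‖ ≤ C)
    (h : ∀ z ∈ ball (0 : ℂ) r, f z = proj 1 (k z)) : BoundedLift f r (max C 1) 1 :=
  ⟨fun _ => 1, k, differentiableOn_const _, hk, fun z hz =>
    ⟨by simp, (hC z hz).trans (le_max_left _ _), by simp, h z hz⟩⟩

/-- Holomorphic maps to the sphere that share `0`, `1` and `∞` with a given one have uniformly
bounded lifts near the origin. -/
theorem exists_boundedLift_of_shareZeroOneInfty {f₀ : ℂ → Sphere} {R : ℝ} (hR : 0 < R)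
    (hf₀ : HolomorphicAtFinite f₀ 0) :
    ∃ r M c : ℝ, 0 < r ∧ 0 < c ∧ ∀ f : ℂ → Sphere,
      (∀ z ∈ ball (0 : ℂ) R, HolomorphicAtFinite f z) →
      ShareZeroOneInfty f f₀ (ball 0 R) → BoundedLift f r M c := by
  -- If `f₀` is constantly 0, 1 or ∞ near the origin, sharing forces every `f` to be the same
  -- constant there.
  have hconst : ∀ p : Sphere, (∀ᶠ w in 𝓝 (0 : ℂ), f₀ w = p) →
      ∃ r : ℝ, 0 < r ∧ r ≤ R ∧ ∀ z ∈ ball (0 : ℂ) r, f₀ z = p := by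
    intro p hp
    obtain ⟨r, hr, h⟩ := Metric.eventually_nhds_iff_ball.1 hp
    exact ⟨min r R, lt_min hr hR, min_le_right _ _,
      fun z hz => h z (ball_subset_ball (min_le_left _ _) hz)⟩
  rcases hf₀.eventually_eq_or_eventually_ne ((0 : ℂ) : Sphere) with h0 | h0
  · obtain ⟨r, hr, hrR, h⟩ := hconst _ h0
    refine ⟨r, 1, 1, hr, one_pos, fun f _ hsh => boundedLift_const (x := 0) (y := 1) (by simp)
      (by simp) (by simp) fun z hz => ?_⟩
    rw [proj_one_right]
    exact ((hsh z (ball_subset_ball hrR hz)).1).2 (h z hz)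
  rcases hf₀.eventually_eq_or_eventually_ne ((1 : ℂ) : Sphere) with h1 | h1
  · obtain ⟨r, hr, hrR, h⟩ := hconst _ h1
    refine ⟨r, 1, 1, hr, one_pos, fun f _ hsh => boundedLift_const (x := 1) (y := 1) (by simp)
      (by simp) (by simp) fun z hz => ?_⟩
    rw [proj_one_right]
    exact ((hsh z (ball_subset_ball hrR hz)).2.1).2 (h z hz)
  rcases hf₀.eventually_eq_or_eventually_ne (∞ : Sphere) with h2 | h2
  · obtain ⟨r, hr, hrR, h⟩ := hconst _ h2
    refine ⟨r, 1, 1, hr, one_pos, fun f _ hsh => boundedLift_const (x := 1) (y := 0) (by simp)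
      (by simp) (by simp) fun z hz => ?_⟩
    rw [proj_zero_right]
    exact ((hsh z (ball_subset_ball hrR hz)).2.2).2 (h z hz)
  -- In the remaining case `f₀`, and hence every `f`, omits 0, 1, ∞ on a punctured disc whose radius
  -- `ρ` does not depend on `f`.
  obtain ⟨r', hr', hp'⟩ := Metric.eventually_nhds_iff_ball.1
    (eventually_nhdsWithin_iff.1 (h0.and (h1.and h2)))
  set ρ := min r' R with hρ
  have hρ0 : 0 < ρ := lt_min hr' hR
  have hρR : ball (0 : ℂ) ρ ⊆ ball 0 R := ball_subset_ball (min_le_right _ _)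
  have hp : ∀ f : ℂ → Sphere, ShareZeroOneInfty f f₀ (ball 0 R) → ∀ z ∈ ball (0 : ℂ) ρ, z ≠ 0 →
      f z ≠ ((0 : ℂ) : Sphere) ∧ f z ≠ ((1 : ℂ) : Sphere) ∧ f z ≠ ∞ := by
    intro f hsh z hz hz0
    obtain ⟨s0, s1, s2⟩ := hsh z (hρR hz)
    obtain ⟨t0, t1, t2⟩ := hp' z (ball_subset_ball (min_le_left _ _) hz) hz0
    exact ⟨mt s0.1 t0, mt s1.1 t1, mt s2.1 t2⟩
  have hoff : ∀ (f : ℂ → Sphere) (p : Sphere), f 0 ≠ p →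
      (∀ z ∈ ball (0 : ℂ) ρ, z ≠ 0 → f z ≠ p) → ∀ z ∈ ball (0 : ℂ) ρ, f z ≠ p := by
    intro f p h0 h z hz
    rcases eq_or_ne z 0 with rfl | hz0
    exacts [h0, h z hz hz0]
  have h00 : (0 : ℂ) ∈ ball (0 : ℂ) R := mem_ball_self hR
  have hfin : ∀ f : ℂ → Sphere, (∀ z ∈ ball (0 : ℂ) R, HolomorphicAtFinite f z) →
      (∀ z ∈ ball (0 : ℂ) ρ, f z ≠ ∞) →
      DifferentiableOn ℂ (fun z => finiteCoord (f z)) (ball 0 ρ) := fun f hf h z hz =>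
    ((hf z (hρR hz)).2.1 (h z hz)).differentiableAt.differentiableWithinAt
  have hinv : ∀ f : ℂ → Sphere, (∀ z ∈ ball (0 : ℂ) R, HolomorphicAtFinite f z) →
      (∀ z ∈ ball (0 : ℂ) ρ, f z ≠ ((0 : ℂ) : Sphere)) →
      DifferentiableOn ℂ (fun z => finiteCoord (inversion (f z))) (ball 0 ρ) := fun f hf h z hz =>
    ((hf z (hρR hz)).differentiableAt_inversion (h z hz)).differentiableWithinAt
  have h01 : ((0 : ℂ) : Sphere) ≠ ((1 : ℂ) : Sphere) := by simp
  obtain ⟨C, hC⟩ := exists_bound_of_zero_only_at_center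
  set r := ρ * Real.exp (-(2 * Real.pi)) with hr
  have hr0 : 0 < r := mul_pos hρ0 (Real.exp_pos _)
  have hrρ : ball (0 : ℂ) r ⊆ ball 0 ρ := ball_subset_ball (by
    have : Real.exp (-(2 * Real.pi)) ≤ 1 := Real.exp_le_one_iff.2 (by linarith [Real.pi_pos])
    rw [hr]; nlinarith)
  -- If `f₀ 0` is one of the three values, every `f` takes that value at 0 and nowhere else on the
  -- disc of radius `ρ`. The central-zero bound is applied to `f`, `1 - f` or `1 / f` for the value
  -- 0, 1 or ∞ respectively.
  by_cases e0 : f₀ 0 = ((0 : ℂ) : Sphere)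
  · refine ⟨r, max C 1, 1, hr0, one_pos, fun f hf hsh => ?_⟩
    have hf0 := (hsh 0 h00).1.2 e0
    have hi := hoff f ∞ (by rw [hf0]; simp) fun z hz hz0 => (hp f hsh z hz hz0).2.2
    have ho := hoff f _ (by rw [hf0]; exact h01) fun z hz hz0 => (hp f hsh z hz hz0).2.1
    have hd := hfin f hf hi
    exact boundedLift_of_finite (hd.mono hrρ)
      (hC _ ρ hρ0 hd (by simp [hf0])
        (fun z hz h => ho z hz ((finiteCoord_eq_iff (hi z hz)).1 h))
        (fun z hz hz0 h => (hp f hsh z hz hz0).1 ((finiteCoord_eq_iff (hi z hz)).1 h)))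
      fun z hz => (proj_finiteCoord_one (hi z (hrρ hz))).symm
  by_cases e1 : f₀ 0 = ((1 : ℂ) : Sphere)
  · refine ⟨r, max (C + 1) 1, 1, hr0, one_pos, fun f hf hsh => ?_⟩
    have hf0 := (hsh 0 h00).2.1.2 e1
    have hi := hoff f ∞ (by rw [hf0]; simp) fun z hz hz0 => (hp f hsh z hz hz0).2.2
    have ho := hoff f _ (by rw [hf0]; exact h01.symm) fun z hz hz0 => (hp f hsh z hz hz0).1
    have hd := hfin f hf hi
    have hb := hC (fun z => 1 - finiteCoord (f z)) ρ hρ0 (hd.const_sub 1) (by simp [hf0])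
      (fun z hz h => ho z hz ((finiteCoord_eq_iff (hi z hz)).1 (by linear_combination -h)))
      (fun z hz hz0 h => (hp f hsh z hz hz0).2.1
        ((finiteCoord_eq_iff (hi z hz)).1 (by linear_combination -h)))
    refine boundedLift_of_finite (hd.mono hrρ) (fun z hz => ?_)
      fun z hz => (proj_finiteCoord_one (hi z (hrρ hz))).symm
    have h3 := norm_sub_le 1 (1 - finiteCoord (f z))
    rw [sub_sub_cancel, norm_one] at h3
    linarith [hb z hz]
  by_cases e2 : f₀ 0 = ∞
  · refine ⟨r, max C 1, 1, hr0, one_pos, fun f hf hsh => ?_⟩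
    have hf0 := (hsh 0 h00).2.2.2 e2
    have hi := hoff f _ (by rw [hf0]; simp) fun z hz hz0 => (hp f hsh z hz hz0).1
    have ho := hoff f _ (by rw [hf0]; simp) fun z hz hz0 => (hp f hsh z hz hz0).2.1
    have hd := hinv f hf hi
    exact boundedLift_of_ne_zero (hd.mono hrρ)
      (hC _ ρ hρ0 hd (by simp [hf0])
        (fun z hz h => ho z hz ((finiteCoord_inversion_eq_one_iff (hi z hz)).1 h))
        (fun z hz hz0 h => (hp f hsh z hz hz0).2.2
          ((finiteCoord_inversion_eq_zero_iff (hi z hz)).1 h)))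
      fun z hz => (proj_one_finiteCoord_inversion (hi z (hrρ hz))).symm
  -- Now `f` omits all three values on the full disc. Whichever of `f` and `1 / f` has modulus at
  -- most 1 at the origin is bounded by Schottky's theorem.
  obtain ⟨C', hC'⟩ := exists_bound_of_omits_zero_one 1
  refine ⟨ρ / 2, max C' 1, 1, half_pos hρ0, one_pos, fun f hf hsh => ?_⟩
  have hz' := hoff f _ (mt (hsh 0 h00).1.1 e0) fun z hz hz0 => (hp f hsh z hz hz0).1
  have ho := hoff f _ (mt (hsh 0 h00).2.1.1 e1) fun z hz hz0 => (hp f hsh z hz hz0).2.1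
  have hi := hoff f _ (mt (hsh 0 h00).2.2.1 e2) fun z hz hz0 => (hp f hsh z hz hz0).2.2
  have hs : ball (0 : ℂ) (ρ / 2) ⊆ ball 0 ρ := ball_subset_ball (by linarith)
  rcases le_total ‖finiteCoord (f 0)‖ 1 with hn | hn
  · refine boundedLift_of_finite ((hfin f hf hi).mono hs) (fun z hz => ?_)
      fun z hz => (proj_finiteCoord_one (hi z (hs hz))).symm
    exact hC' _ 0 ρ hρ0 (hfin f hf hi) (fun z hz =>
      ⟨fun h => hz' z hz ((finiteCoord_eq_iff (hi z hz)).1 h),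
        fun h => ho z hz ((finiteCoord_eq_iff (hi z hz)).1 h)⟩) hn z (ball_subset_closedBall hz)
  · refine boundedLift_of_ne_zero ((hinv f hf hz').mono hs) (fun z hz => ?_)
      fun z hz => (proj_one_finiteCoord_inversion (hz' z (hs hz))).symm
    refine hC' _ 0 ρ hρ0 (hinv f hf hz') (fun z hz =>
      ⟨fun h => hi z hz ((finiteCoord_inversion_eq_zero_iff (hz' z hz)).1 h),
        fun h => ho z hz ((finiteCoord_inversion_eq_one_iff (hz' z hz)).1 h)⟩) ?_ z
      (ball_subset_closedBall hz)
    have h4 := hi 0 (mem_ball_self hρ0)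
    have h5 := hz' 0 (mem_ball_self hρ0)
    generalize f 0 = p at h4 h5 hn ⊢
    induction p using OnePoint.rec with
    | infty => exact absurd rfl h4
    | coe b =>
      have hb : b ≠ 0 := by simpa using h5
      rw [inversion_coe, if_neg hb, finiteCoord_coe, norm_inv]
      exact inv_le_one_of_one_le₀ hn

/-! ### The cross ratio and its inversion -/

/-- The cross ratio, as a point of the sphere: the image of `p` under the Möbius transformation that
takes `a`, `b`, `c` to `0`, `1`, `∞`. -/
noncomputable def crossRatio (p a b c : Sphere) : Sphere :=
  proj ((liftX p * liftY a - liftX a * liftY p) * (liftX b * liftY c - liftX c * liftY b))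
    ((liftX p * liftY c - liftX c * liftY p) * (liftX b * liftY a - liftX a * liftY b))

theorem crossRatio_lift_ne_zero {p a b c : Sphere} (hab : a ≠ b) (hac : a ≠ c) (hbc : b ≠ c) :
    (liftX p * liftY a - liftX a * liftY p) * (liftX b * liftY c - liftX c * liftY b) ≠ 0 ∨
    (liftX p * liftY c - liftX c * liftY p) * (liftX b * liftY a - liftX a * liftY b) ≠ 0 := by
  have h1 : liftX b * liftY c - liftX c * liftY b ≠ 0 := mt lift_det_eq_zero_iff.1 hbc
  have h2 : liftX b * liftY a - liftX a * liftY b ≠ 0 := mt lift_det_eq_zero_iff.1 hab.symm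
  by_contra! h
  have h3 := (mul_eq_zero.1 h.1).resolve_right h1
  have h4 := (mul_eq_zero.1 h.2).resolve_right h2
  exact hac ((lift_det_eq_zero_iff.1 h3).symm.trans (lift_det_eq_zero_iff.1 h4))

theorem crossRatio_eq_zero_iff {p a b c : Sphere} (hab : a ≠ b) (hac : a ≠ c) (hbc : b ≠ c) :
    crossRatio p a b c = ((0 : ℂ) : Sphere) ↔ p = a := by
  have h1 : liftX b * liftY c - liftX c * liftY b ≠ 0 := mt lift_det_eq_zero_iff.1 hbc
  rw [crossRatio, ← proj_one_right 0,
    proj_eq_proj_iff (crossRatio_lift_ne_zero hab hac hbc) (Or.inr one_ne_zero), mul_one, zero_mul,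
    mul_eq_zero, or_iff_left h1, lift_det_eq_zero_iff]

theorem crossRatio_eq_infty_iff {p a b c : Sphere} (hab : a ≠ b) :
    crossRatio p a b c = ∞ ↔ p = c := by
  have h2 : liftX b * liftY a - liftX a * liftY b ≠ 0 := mt lift_det_eq_zero_iff.1 hab.symm
  rw [crossRatio, proj_eq_infty_iff, mul_eq_zero, or_iff_left h2, lift_det_eq_zero_iff]

/-- The Plücker relation `[p,a][b,c] - [p,c][b,a] = [p,b][a,c]` for the determinants of coordinates.
-/
theorem crossRatio_eq_one_iff {p a b c : Sphere} (hab : a ≠ b) (hac : a ≠ c) (hbc : b ≠ c) :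
    crossRatio p a b c = ((1 : ℂ) : Sphere) ↔ p = b := by
  have h1 : liftX a * liftY c - liftX c * liftY a ≠ 0 := mt lift_det_eq_zero_iff.1 hac
  rw [crossRatio, ← proj_one_right 1,
    proj_eq_proj_iff (crossRatio_lift_ne_zero hab hac hbc) (Or.inr one_ne_zero), mul_one, one_mul,
    ← sub_eq_zero, show
      (liftX p * liftY a - liftX a * liftY p) * (liftX b * liftY c - liftX c * liftY b) -
      (liftX p * liftY c - liftX c * liftY p) * (liftX b * liftY a - liftX a * liftY b) =
      -((liftX p * liftY b - liftX b * liftY p) * (liftX a * liftY c - liftX c * liftY a)) * (-1)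
      by ring, mul_eq_zero, or_iff_left (by norm_num), neg_eq_zero, mul_eq_zero, or_iff_left h1,
    lift_det_eq_zero_iff]

theorem crossRatio_proj {x y x₁ y₁ x₂ y₂ x₃ y₃ : ℂ} (h : x ≠ 0 ∨ y ≠ 0) (h₁ : x₁ ≠ 0 ∨ y₁ ≠ 0)
    (h₂ : x₂ ≠ 0 ∨ y₂ ≠ 0) (h₃ : x₃ ≠ 0 ∨ y₃ ≠ 0) :
    crossRatio (proj x y) (proj x₁ y₁) (proj x₂ y₂) (proj x₃ y₃) =
      proj ((x * y₁ - x₁ * y) * (x₂ * y₃ - x₃ * y₂)) ((x * y₃ - x₃ * y) * (x₂ * y₁ - x₁ * y₂)) := by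
  obtain ⟨t, ht, hx, hy⟩ := exists_lift_proj h
  obtain ⟨t₁, ht₁, hx₁, hy₁⟩ := exists_lift_proj h₁
  obtain ⟨t₂, ht₂, hx₂, hy₂⟩ := exists_lift_proj h₂
  obtain ⟨t₃, ht₃, hx₃, hy₃⟩ := exists_lift_proj h₃
  generalize proj x y = p at *
  generalize proj x₁ y₁ = a at *
  generalize proj x₂ y₂ = b at *
  generalize proj x₃ y₃ = c at *
  subst hx hy hx₁ hy₁ hx₂ hy₂ hx₃ hy₃
  rw [crossRatio, ← proj_mul_left (mul_ne_zero (mul_ne_zero ht ht₁) (mul_ne_zero ht₂ ht₃))]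
  congr 1 <;> ring

/-- A point is recovered from its cross ratio. -/
theorem eq_proj_of_crossRatio_eq {p : Sphere} {s t x₁ y₁ x₂ y₂ x₃ y₃ : ℂ} (hst : s ≠ 0 ∨ t ≠ 0)
    (h₁ : x₁ ≠ 0 ∨ y₁ ≠ 0) (h₂ : x₂ ≠ 0 ∨ y₂ ≠ 0) (h₃ : x₃ ≠ 0 ∨ y₃ ≠ 0)
    (h₁₂ : proj x₁ y₁ ≠ proj x₂ y₂) (h₁₃ : proj x₁ y₁ ≠ proj x₃ y₃)
    (h₂₃ : proj x₂ y₂ ≠ proj x₃ y₃)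
    (hw : s * (x₂ * y₁ - x₁ * y₂) * x₃ - t * (x₂ * y₃ - x₃ * y₂) * x₁ ≠ 0 ∨
      s * (x₂ * y₁ - x₁ * y₂) * y₃ - t * (x₂ * y₃ - x₃ * y₂) * y₁ ≠ 0)
    (h : crossRatio p (proj x₁ y₁) (proj x₂ y₂) (proj x₃ y₃) = proj s t) :
    p = proj (s * (x₂ * y₁ - x₁ * y₂) * x₃ - t * (x₂ * y₃ - x₃ * y₂) * x₁)
      (s * (x₂ * y₁ - x₁ * y₂) * y₃ - t * (x₂ * y₃ - x₃ * y₂) * y₁) := by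
  have hp := lift_ne_zero p
  have hne := crossRatio_lift_ne_zero (p := p) h₁₂ h₁₃ h₂₃
  rw [← proj_lift p] at h ⊢
  rw [crossRatio_proj hp h₁ h₂ h₃, proj_eq_proj_iff ?_ hst] at h
  -- The cross ratio equation is linear in the coordinates of `p`; equality with the proposed point
  -- is the same linear equation up to sign.
  · rw [proj_eq_proj_iff hp hw]
    linear_combination -h
  · by_contra! h0
    have h12 : x₂ * y₁ - x₁ * y₂ ≠ 0 := by
      rw [sub_ne_zero, Ne, ← proj_eq_proj_iff h₂ h₁]; exact h₁₂.symm
    have h23 : x₂ * y₃ - x₃ * y₂ ≠ 0 := by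
      rw [sub_ne_zero, Ne, ← proj_eq_proj_iff h₂ h₃]; exact h₂₃
    have e1 := (mul_eq_zero.1 h0.1).resolve_right h23
    have e2 := (mul_eq_zero.1 h0.2).resolve_right h12
    rw [sub_eq_zero, ← proj_eq_proj_iff hp h₁] at e1
    rw [sub_eq_zero, ← proj_eq_proj_iff hp h₃] at e2
    exact h₁₃ (e1.symm.trans e2)

theorem HolomorphicAtFinite.crossRatio {f a b c : ℂ → Sphere} {z : ℂ}
    (hf : HolomorphicAtFinite f z) (ha : HolomorphicAtFinite a z) (hb : HolomorphicAtFinite b z)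
    (hc : HolomorphicAtFinite c z) (hab : a z ≠ b z) (hac : a z ≠ c z) (hbc : b z ≠ c z) :
    HolomorphicAtFinite (fun w => crossRatio (f w) (a w) (b w) (c w)) z := by
  obtain ⟨x, y, hx, hy, h⟩ := hf.exists_proj
  obtain ⟨x₁, y₁, hx₁, hy₁, h₁⟩ := ha.exists_proj
  obtain ⟨x₂, y₂, hx₂, hy₂, h₂⟩ := hb.exists_proj
  obtain ⟨x₃, y₃, hx₃, hy₃, h₃⟩ := hc.exists_proj
  refine holomorphicAtFinite_of_proj
    (x := fun w => (x w * y₁ w - x₁ w * y w) * (x₂ w * y₃ w - x₃ w * y₂ w))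
    (y := fun w => (x w * y₃ w - x₃ w * y w) * (x₂ w * y₁ w - x₁ w * y₂ w))
    (((hx.mul hy₁).sub (hx₁.mul hy)).mul ((hx₂.mul hy₃).sub (hx₃.mul hy₂)))
    (((hx.mul hy₃).sub (hx₃.mul hy)).mul ((hx₂.mul hy₁).sub (hx₁.mul hy₂))) ?_ ?_
  · obtain ⟨k, l⟩ := h.self_of_nhds
    obtain ⟨k₁, l₁⟩ := h₁.self_of_nhds
    obtain ⟨k₂, l₂⟩ := h₂.self_of_nhds
    obtain ⟨k₃, l₃⟩ := h₃.self_of_nhds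
    rw [l₁, l₂, Ne, proj_eq_proj_iff k₁ k₂] at hab
    rw [l₁, l₃, Ne, proj_eq_proj_iff k₁ k₃] at hac
    rw [l₂, l₃, Ne, proj_eq_proj_iff k₂ k₃] at hbc
    by_contra! h0
    have e1 := (mul_eq_zero.1 h0.1).resolve_right (sub_ne_zero.2 hbc)
    have e2 := (mul_eq_zero.1 h0.2).resolve_right (sub_ne_zero.2 (Ne.symm hab))
    rw [sub_eq_zero, ← proj_eq_proj_iff k k₁] at e1
    rw [sub_eq_zero, ← proj_eq_proj_iff k k₃] at e2
    exact hac ((proj_eq_proj_iff k₁ k₃).1 (e1.symm.trans e2))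
  · filter_upwards [h, h₁, h₂, h₃] with w k k₁ k₂ k₃
    rw [k.2, k₁.2, k₂.2, k₃.2, crossRatio_proj k.1 k₁.1 k₂.1 k₃.1]

theorem mul_le_norm_det {x y u v : ℂ} {c κ : ℝ} (hc : 0 < c) (hκ : 0 ≤ κ) (h : c ≤ max ‖x‖ ‖y‖)
    (h' : c ≤ max ‖u‖ ‖v‖) (hsep : κ ≤ chord (proj x y) (proj u v)) :
    κ * (c * c) ≤ ‖x * v - u * y‖ := by
  rw [chord_proj (ne_zero_of_le_max hc h) (ne_zero_of_le_max hc h')] at hsep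
  have h1 := le_max_sqrt h
  have h2 := le_max_sqrt h'
  have hpos : 0 < √(‖x‖ ^ 2 + ‖y‖ ^ 2) * √(‖u‖ ^ 2 + ‖v‖ ^ 2) :=
    mul_pos (hc.trans_le h1) (hc.trans_le h2)
  rw [le_div_iff₀ hpos] at hsep
  refine le_trans ?_ hsep
  gcongr

theorem norm_det_le {x y u v : ℂ} {M : ℝ} (hu : ‖u‖ ≤ M) (hv : ‖v‖ ≤ M) :
    ‖x * v - u * y‖ ≤ 2 * M * max ‖x‖ ‖y‖ := by
  have hM := (norm_nonneg u).trans hu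
  calc ‖x * v - u * y‖ ≤ ‖x * v‖ + ‖u * y‖ := norm_sub_le _ _
    _ = ‖x‖ * ‖v‖ + ‖u‖ * ‖y‖ := by rw [norm_mul, norm_mul]
    _ ≤ max ‖x‖ ‖y‖ * M + M * max ‖x‖ ‖y‖ := by
      gcongr
      exacts [le_max_left _ _, le_max_right _ _]
    _ = 2 * M * max ‖x‖ ‖y‖ := by ring

theorem ne_of_le_chord {p q : Sphere} {κ : ℝ} (hκ : 0 < κ) (h : κ ≤ chord p q) : p ≠ q := by
  rintro rfl
  simp only [chord, sub_self, norm_zero, zero_div] at h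
  linarith

/-- The lift is `W = s[2,1] a₃ - t[2,3] a₁`, where `[j,k]` is the determinant of the lifts of `a_j`
and `a_k`. Pairing `W` with `a₁` leaves `s[2,1][3,1]`, and pairing with `a₃` leaves `-t[2,3][1,3]`.
One of `|s|`, `|t|` is at least `c`, the determinants are at least `κ c²`, and a pairing is at most
`2M` times the larger coordinate of `W`; this is the lower bound. -/
theorem BoundedLift.of_crossRatio {f a₁ a₂ a₃ : ℂ → Sphere} {r M c κ : ℝ} (hM : 0 < M) (hc : 0 < c)
    (hκ : 0 < κ) (h₁ : BoundedLift a₁ r M c) (h₂ : BoundedLift a₂ r M c)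
    (h₃ : BoundedLift a₃ r M c)
    (h : BoundedLift (fun z => crossRatio (f z) (a₁ z) (a₂ z) (a₃ z)) r M c)
    (h₁₂ : ∀ z ∈ ball (0 : ℂ) r, κ ≤ chord (a₁ z) (a₂ z))
    (h₁₃ : ∀ z ∈ ball (0 : ℂ) r, κ ≤ chord (a₁ z) (a₃ z))
    (h₂₃ : ∀ z ∈ ball (0 : ℂ) r, κ ≤ chord (a₂ z) (a₃ z)) :
    BoundedLift f r (4 * M ^ 4) (c * (κ * (c * c)) ^ 2 / (2 * M)) := by
  obtain ⟨x₁, y₁, hx₁, hy₁, h₁⟩ := h₁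
  obtain ⟨x₂, y₂, hx₂, hy₂, h₂⟩ := h₂
  obtain ⟨x₃, y₃, hx₃, hy₃, h₃⟩ := h₃
  obtain ⟨s, t, hs, ht, h⟩ := h
  have hd21 := (hx₂.mul hy₁).sub (hx₁.mul hy₂)
  have hd23 := (hx₂.mul hy₃).sub (hx₃.mul hy₂)
  refine ⟨fun z => s z * (x₂ z * y₁ z - x₁ z * y₂ z) * x₃ z -
      t z * (x₂ z * y₃ z - x₃ z * y₂ z) * x₁ z,
    fun z => s z * (x₂ z * y₁ z - x₁ z * y₂ z) * y₃ z -
      t z * (x₂ z * y₃ z - x₃ z * y₂ z) * y₁ z,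
    ((hs.mul hd21).mul hx₃).sub ((ht.mul hd23).mul hx₁),
    ((hs.mul hd21).mul hy₃).sub ((ht.mul hd23).mul hy₁), fun z hz => ?_⟩
  obtain ⟨k₁, l₁, m₁, e₁⟩ := h₁ z hz
  obtain ⟨k₂, l₂, m₂, e₂⟩ := h₂ z hz
  obtain ⟨k₃, l₃, m₃, e₃⟩ := h₃ z hz
  obtain ⟨k, l, m, e⟩ := h z hz
  have g₁₂ := h₁₂ z hz
  have g₁₃ := h₁₃ z hz
  have g₂₃ := h₂₃ z hz
  rw [e₁, e₂] at g₁₂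
  rw [e₁, e₃] at g₁₃
  rw [e₂, e₃] at g₂₃
  beta_reduce at e ⊢
  rw [e₁, e₂, e₃] at e
  have d12 := mul_le_norm_det hc hκ.le m₁ m₂ g₁₂
  have d13 := mul_le_norm_det hc hκ.le m₁ m₃ g₁₃
  have d23 := mul_le_norm_det hc hκ.le m₂ m₃ g₂₃
  have d21 : κ * (c * c) ≤ ‖x₂ z * y₁ z - x₁ z * y₂ z‖ := by
    rwa [norm_sub_rev]
  have d31 : κ * (c * c) ≤ ‖x₃ z * y₁ z - x₁ z * y₃ z‖ := by
    rwa [norm_sub_rev]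
  have u21 : ‖x₂ z * y₁ z - x₁ z * y₂ z‖ ≤ 2 * M * M :=
    (norm_det_le k₁ l₁).trans (by gcongr; exact max_le k₂ l₂)
  have u23 : ‖x₂ z * y₃ z - x₃ z * y₂ z‖ ≤ 2 * M * M :=
    (norm_det_le k₃ l₃).trans (by gcongr; exact max_le k₂ l₂)
  have hup : ∀ p q : ℂ, ‖p‖ ≤ M → ‖q‖ ≤ M →
      ‖s z * (x₂ z * y₁ z - x₁ z * y₂ z) * p - t z * (x₂ z * y₃ z - x₃ z * y₂ z) * q‖ ≤
        4 * M ^ 4 := by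
    intro p q hp hq
    refine (norm_sub_le _ _).trans ?_
    rw [norm_mul, norm_mul, norm_mul, norm_mul]
    calc _ ≤ M * (2 * M * M) * M + M * (2 * M * M) * M := by gcongr
      _ = 4 * M ^ 4 := by ring
  have hlow : c * (κ * (c * c)) ^ 2 / (2 * M) ≤
      max ‖s z * (x₂ z * y₁ z - x₁ z * y₂ z) * x₃ z - t z * (x₂ z * y₃ z - x₃ z * y₂ z) * x₁ z‖
        ‖s z * (x₂ z * y₁ z - x₁ z * y₂ z) * y₃ z -
          t z * (x₂ z * y₃ z - x₃ z * y₂ z) * y₁ z‖ := by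
    rw [div_le_iff₀' (by positivity)]
    rcases le_max_iff.1 m with m | m
    · refine le_trans ?_ (norm_det_le k₁ l₁)
      rw [show (s z * (x₂ z * y₁ z - x₁ z * y₂ z) * x₃ z -
          t z * (x₂ z * y₃ z - x₃ z * y₂ z) * x₁ z) * y₁ z -
          x₁ z * (s z * (x₂ z * y₁ z - x₁ z * y₂ z) * y₃ z -
          t z * (x₂ z * y₃ z - x₃ z * y₂ z) * y₁ z) =
          s z * ((x₂ z * y₁ z - x₁ z * y₂ z) * (x₃ z * y₁ z - x₁ z * y₃ z)) by ring,
        norm_mul, norm_mul, sq]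
      gcongr
    · refine le_trans ?_ (norm_det_le k₃ l₃)
      rw [show (s z * (x₂ z * y₁ z - x₁ z * y₂ z) * x₃ z -
          t z * (x₂ z * y₃ z - x₃ z * y₂ z) * x₁ z) * y₃ z -
          x₃ z * (s z * (x₂ z * y₁ z - x₁ z * y₂ z) * y₃ z -
          t z * (x₂ z * y₃ z - x₃ z * y₂ z) * y₁ z) =
          -(t z * ((x₂ z * y₃ z - x₃ z * y₂ z) * (x₁ z * y₃ z - x₃ z * y₁ z))) by ring,
        norm_neg, norm_mul, norm_mul, sq]
      gcongr
  refine ⟨hup _ _ k₃ k₁, hup _ _ l₃ l₁, hlow, ?_⟩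
  exact eq_proj_of_crossRatio_eq (ne_zero_of_le_max hc m) (ne_zero_of_le_max hc m₁)
    (ne_zero_of_le_max hc m₂) (ne_zero_of_le_max hc m₃) (ne_of_le_chord hκ g₁₂)
    (ne_of_le_chord hκ g₁₃) (ne_of_le_chord hκ g₂₃) (ne_zero_of_le_max (by positivity) hlow) e

/-- A family of holomorphic maps to the sphere on a disc that share three separated holomorphic
targets has uniformly bounded lifts near the centre. -/
theorem exists_boundedLift_of_share_targets {ι : Type*} {f : ι → ℂ → Sphere}
    {a : ι → Fin 3 → ℂ → Sphere} {R κ : ℝ} (hR : 0 < R) (hκ : 0 < κ)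
    (hf : ∀ i, ∀ z ∈ ball (0 : ℂ) R, HolomorphicAtFinite (f i) z)
    (ha : ∀ i j, ∀ z ∈ ball (0 : ℂ) R, HolomorphicAtFinite (a i j) z)
    (hsep : ∀ i j k, j ≠ k → ∀ z ∈ ball (0 : ℂ) R, κ ≤ chord (a i j z) (a i k z))
    (hshare : ∀ i i' j, ∀ z ∈ ball (0 : ℂ) R, f i z = a i j z ↔ f i' z = a i' j z) :
    ∃ r M c : ℝ, 0 < r ∧ 0 < c ∧ ∀ i, BoundedLift (f i) r M c := by
  rcases isEmpty_or_nonempty ι with hι | ⟨⟨i₀⟩⟩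
  · exact ⟨1, 1, 1, one_pos, one_pos, fun i => (hι.false i).elim⟩
  have hne : ∀ i j k, j ≠ k → ∀ z ∈ ball (0 : ℂ) R, a i j z ≠ a i k z := fun i j k hjk z hz =>
    ne_of_le_chord hκ (hsep i j k hjk z hz)
  have h01 : (0 : Fin 3) ≠ 1 := by decide
  have h02 : (0 : Fin 3) ≠ 2 := by decide
  have h12 : (1 : Fin 3) ≠ 2 := by decide
  -- Taking cross ratios replaces the moving targets by the fixed values 0, 1, ∞, which all `h i`
  -- share with `h i₀`.
  let h : ι → ℂ → Sphere := fun i z => crossRatio (f i z) (a i 0 z) (a i 1 z) (a i 2 z)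
  have hh : ∀ i, ∀ z ∈ ball (0 : ℂ) R, HolomorphicAtFinite (h i) z := fun i z hz =>
    (hf i z hz).crossRatio (ha i 0 z hz) (ha i 1 z hz) (ha i 2 z hz) (hne i _ _ h01 z hz)
      (hne i _ _ h02 z hz) (hne i _ _ h12 z hz)
  have hhs : ∀ i, ShareZeroOneInfty (h i) (h i₀) (ball 0 R) := by
    intro i z hz
    have n01 := fun i => hne i _ _ h01 z hz
    have n02 := fun i => hne i _ _ h02 z hz
    have n12 := fun i => hne i _ _ h12 z hz
    simp only [h, crossRatio_eq_zero_iff (n01 _) (n02 _) (n12 _),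
      crossRatio_eq_one_iff (n01 _) (n02 _) (n12 _), crossRatio_eq_infty_iff (n01 _)]
    exact ⟨hshare i i₀ 0 z hz, hshare i i₀ 1 z hz, hshare i i₀ 2 z hz⟩
  obtain ⟨r₁, M₁, c₁, hr₁, hc₁, hB⟩ :=
    exists_boundedLift_of_shareZeroOneInfty hR (hh i₀ 0 (mem_ball_self hR))
  have hκ' : 0 < min κ 1 := lt_min hκ one_pos
  -- Each target gets its bounded lift from its separation from one of the others.
  have hpair : ∀ i j k, j ≠ k →
      BoundedLift (a i j) (min κ 1 * R / 8) (1 / min κ 1) (1 / 4) := fun i j k hjk =>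
    boundedLift_of_le_chord hR hκ' (min_le_right _ _) (ha i j) (ha i k)
      fun z hz => (min_le_left _ _).trans (hsep i j k hjk z hz)
  set r := min R (min r₁ (min κ 1 * R / 8)) with hr
  set M := max M₁ (1 / min κ 1) with hM
  set c := min c₁ (1 / 4) with hc
  have hr0 : 0 < r := lt_min hR (lt_min hr₁ (by positivity))
  have hM0 : 0 < M := lt_max_of_lt_right (by positivity)
  have hc0 : 0 < c := lt_min hc₁ (by norm_num)
  have hrR : ball (0 : ℂ) r ⊆ ball 0 R := ball_subset_ball (min_le_left _ _)
  have hpair' : ∀ i j k, j ≠ k → BoundedLift (a i j) r M c := fun i j k hjk =>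
    (hpair i j k hjk).mono ((min_le_right _ _).trans (min_le_right _ _)) (le_max_right _ _)
      (min_le_right _ _)
  refine ⟨r, _, _, hr0, ?_, fun i => BoundedLift.of_crossRatio hM0 hc0 hκ (hpair' i 0 1 h01)
    (hpair' i 1 2 h12) (hpair' i 2 1 h12.symm) ((hB (h i) (hh i) (hhs i)).mono
      ((min_le_right _ _).trans (min_le_left _ _)) (le_max_left _ _) (min_le_left _ _))
    (fun z hz => hsep i _ _ h01 z (hrR hz)) (fun z hz => hsep i _ _ h02 z (hrR hz))
    (fun z hz => hsep i _ _ h12 z (hrR hz))⟩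
  positivity

/-! ### Convergent subsequences and diagonal extraction -/

/-- The sequence `v` converges to `g` on `s`, pointwise in the sphere and uniformly in the spherical
metric, and `g` is holomorphic on `s`. -/
structure ConvergesHolomorphically (v : ℕ → ℂ → Sphere) (g : ℂ → Sphere) (s : Set ℂ) : Prop where
  holomorphic : ∀ z ∈ s, HolomorphicAtFinite g z
  tendsto : ∀ z ∈ s, Tendsto (fun n => v n z) atTop (𝓝 (g z))
  uniform : ∀ δ : ℝ, 0 < δ → ∃ N : ℕ, ∀ n ≥ N, ∀ z ∈ s, sphericalDist (v n z) (g z) < δ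

theorem ConvergesHolomorphically.of_tail {v v' : ℕ → ℂ → Sphere} {g : ℂ → Sphere} {s : Set ℂ}
    (h : ConvergesHolomorphically v g s) {N : ℕ} (hv : ∀ n ≥ N, ∃ m ≥ n, v' n = v m) :
    ConvergesHolomorphically v' g s := by
  refine ⟨h.holomorphic, fun z hz => ?_, fun δ hδ => ?_⟩
  · rw [Filter.tendsto_atTop']
    intro U hU
    obtain ⟨N', hN'⟩ := (Filter.tendsto_atTop'.1 (h.tendsto z hz)) U hU
    refine ⟨max N N', fun n hn => ?_⟩
    obtain ⟨m, hm, hvm⟩ := hv n ((le_max_left _ _).trans hn)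
    rw [hvm]
    exact hN' m (((le_max_right _ _).trans hn).trans hm)
  · obtain ⟨N', hN'⟩ := h.uniform δ hδ
    refine ⟨max N N', fun n hn => ?_⟩
    obtain ⟨m, hm, hvm⟩ := hv n ((le_max_left _ _).trans hn)
    rw [hvm]
    exact hN' m (((le_max_right _ _).trans hn).trans hm)

/-- Montel's theorem applies to both coordinates. The lower bound `c` survives in the limit, so the
limit coordinates have no common zero, and it also turns smallness of the determinant `x Y - X y`
into spherical closeness. -/
theorem exists_subseq_convergesHolomorphically {v : ℕ → ℂ → Sphere} {r M c : ℝ} (hr : 0 < r)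
    (hc : 0 < c) (h : ∀ n, BoundedLift (v n) r M c) :
    ∃ φ : ℕ → ℕ, StrictMono φ ∧ ∃ g : ℂ → Sphere,
      ConvergesHolomorphically (fun n => v (φ n)) g (ball 0 (r / 2)) := by
  choose x y hx hy h using h
  obtain ⟨φ₁, hφ₁, X, hX, hxX⟩ :=
    exists_subseq_tendstoUniformlyOn hr hx (fun n z hz => (h n z hz).1)
  obtain ⟨φ₂, hφ₂, Y, hY, hyY⟩ := exists_subseq_tendstoUniformlyOn hr (fun n => hy (φ₁ n))
    (fun n z hz => (h (φ₁ n) z hz).2.1)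
  have hxX' : TendstoUniformlyOn (fun n => x (φ₁ (φ₂ n))) X atTop (ball 0 (r / 2)) :=
    fun U hU => hφ₂.tendsto_atTop.eventually (hxX U hU)
  have hs : ball (0 : ℂ) (r / 2) ⊆ ball 0 r := ball_subset_ball (by linarith)
  have tx := fun z (hz : z ∈ ball (0 : ℂ) (r / 2)) => hxX'.tendsto_at hz
  have ty := fun z (hz : z ∈ ball (0 : ℂ) (r / 2)) => hyY.tendsto_at hz
  have hXM : ∀ z ∈ ball (0 : ℂ) (r / 2), ‖X z‖ ≤ M := fun z hz =>
    le_of_tendsto' (tx z hz).norm fun n => (h _ z (hs hz)).1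
  have hYM : ∀ z ∈ ball (0 : ℂ) (r / 2), ‖Y z‖ ≤ M := fun z hz =>
    le_of_tendsto' (ty z hz).norm fun n => (h _ z (hs hz)).2.1
  have hXY : ∀ z ∈ ball (0 : ℂ) (r / 2), c ≤ max ‖X z‖ ‖Y z‖ := fun z hz =>
    ge_of_tendsto' ((tx z hz).norm.max (ty z hz).norm) fun n => (h _ z (hs hz)).2.2.1
  have hM0 : 0 ≤ M := (norm_nonneg _).trans (hXM 0 (mem_ball_self (by linarith)))
  refine ⟨fun n => φ₁ (φ₂ n), hφ₁.comp hφ₂, fun z => proj (X z) (Y z), fun z hz => ?_,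
    fun z hz => ?_, fun δ hδ => ?_⟩
  · exact holomorphicAtFinite_of_proj (hX.analyticAt (isOpen_ball.mem_nhds hz))
      (hY.analyticAt (isOpen_ball.mem_nhds hz)) (ne_zero_of_le_max hc (hXY z hz))
      (EventuallyEq.refl _ _)
  · refine (tendsto_proj (tx z hz) (ty z hz) (ne_zero_of_le_max hc (hXY z hz))).congr fun n => ?_
    exact (h _ z (hs hz)).2.2.2.symm
  · have hpi := Real.pi_pos
    -- Chosen so that the final estimate is `δ · M / (M + 1) < δ`; the `M + 1` keeps the denominator
    -- positive when `M = 0`.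
    set η := δ * (c * c) / (2 * Real.pi * (M + 1)) with hη
    have hη0 : 0 < η := by positivity
    obtain ⟨N, hN⟩ := eventually_atTop.1
      ((Metric.tendstoUniformlyOn_iff.1 hxX' η hη0).and
        (Metric.tendstoUniformlyOn_iff.1 hyY η hη0))
    refine ⟨N, fun n hn z hz => ?_⟩
    obtain ⟨h1, h2⟩ := hN n hn
    have h1 := h1 z hz
    have h2 := h2 z hz
    rw [dist_comm, dist_eq_norm] at h1 h2
    obtain ⟨-, -, h3, h4⟩ := h (φ₁ (φ₂ n)) z (hs hz)
    have h5 : ‖x (φ₁ (φ₂ n)) z * Y z - X z * y (φ₁ (φ₂ n)) z‖ ≤ 2 * M * η := by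
      rw [show x (φ₁ (φ₂ n)) z * Y z - X z * y (φ₁ (φ₂ n)) z =
        (x (φ₁ (φ₂ n)) z - X z) * Y z - X z * (y (φ₁ (φ₂ n)) z - Y z) by ring]
      refine (norm_sub_le _ _).trans ?_
      rw [norm_mul, norm_mul]
      calc _ ≤ η * M + M * η := by
            gcongr
            exacts [hYM z hz, hXM z hz]
        _ = 2 * M * η := by ring
    rw [h4]
    refine (sphericalDist_proj_le hc h3 (hXY z hz)).trans_lt ?_
    calc Real.pi * (‖x (φ₁ (φ₂ n)) z * Y z - X z * y (φ₁ (φ₂ n)) z‖ / (c * c))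
        ≤ Real.pi * (2 * M * η / (c * c)) := by gcongr
      _ = δ * (M / (M + 1)) := by rw [hη]; field_simp
      _ < δ * 1 := by
          gcongr
          rw [div_lt_one (by linarith)]
          linarith
      _ = δ := mul_one δ

/-- Diagonal extraction: countably many properties of subsequences, each of which holds after
passing to a further subsequence and depends only on the tail, hold simultaneously for some
subsequence. -/
theorem exists_strictMono_forall {P : ℕ → (ℕ → ℕ) → Prop}
    (hex : ∀ k φ, StrictMono φ → ∃ ψ : ℕ → ℕ, StrictMono ψ ∧ P k (φ ∘ ψ))
    (htail : ∀ k φ φ' N, P k φ → (∀ n ≥ N, ∃ m ≥ n, φ' n = φ m) → P k φ') :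
    ∃ φ : ℕ → ℕ, StrictMono φ ∧ ∀ k, P k φ := by
  choose ψ hψ hP using hex
  let Φ : ℕ → {φ : ℕ → ℕ // StrictMono φ} := fun n =>
    Nat.rec ⟨id, strictMono_id⟩ (fun k φ => ⟨φ.1 ∘ ψ k φ.1 φ.2, φ.2.comp (hψ k φ.1 φ.2)⟩) n
  have hΦ : ∀ k, (Φ (k + 1)).1 = (Φ k).1 ∘ ψ k (Φ k).1 (Φ k).2 := fun k => rfl
  have hfact : ∀ k j, ∃ θ : ℕ → ℕ, StrictMono θ ∧ (Φ (k + j)).1 = (Φ k).1 ∘ θ := by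
    intro k j
    induction j with
    | zero => exact ⟨id, strictMono_id, rfl⟩
    | succ j ih =>
      obtain ⟨θ, hθ, h⟩ := ih
      refine ⟨θ ∘ ψ (k + j) (Φ (k + j)).1 (Φ (k + j)).2, hθ.comp (hψ _ _ _), ?_⟩
      rw [← add_assoc, hΦ, ← Function.comp_assoc]
      exact congrArg (· ∘ _) h
  refine ⟨fun n => (Φ n).1 n, strictMono_nat_of_lt_succ fun n => ?_, fun k => ?_⟩
  · rw [hΦ]
    exact (Φ n).2 ((Nat.lt_succ_self n).trans_le ((hψ n _ (Φ n).2).le_apply))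
  · refine htail k _ _ (k + 1) (hP k (Φ k).1 (Φ k).2) fun n hn => ?_
    -- Property `k` is secured by `Φ (k + 1)`, and from index `k + 1` on the diagonal consists of
    -- later terms of that sequence.
    obtain ⟨j, rfl⟩ := Nat.exists_eq_add_of_le hn
    obtain ⟨θ, hθ, h⟩ := hfact (k + 1) j
    exact ⟨θ (k + 1 + j), hθ.le_apply, congrFun h _⟩

/-! ### Charts and the passage from local to global -/

/-- The standard local coordinate of the sphere, centred at a given point. -/
noncomputable def chart : Sphere → ℂ → Sphere
  | ∞, w => inversion (w : Sphere)
  | (z : ℂ), w => ((z + w : ℂ) : Sphere)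

theorem chart_infty (w : ℂ) : chart ∞ w = inversion (w : Sphere) := rfl

theorem chart_coe (z w : ℂ) : chart (z : Sphere) w = ((z + w : ℂ) : Sphere) := rfl

theorem chart_zero (p : Sphere) : chart p 0 = p := by
  induction p using OnePoint.rec <;> simp [chart_infty, chart_coe, inversion_coe]

theorem tendsto_chart_zero (p : Sphere) : Tendsto (chart p) (𝓝 0) (𝓝 p) := by
  induction p using OnePoint.rec with
  | infty => exact tendsto_inversion_coe_zero
  | coe z =>
    have h : Continuous (chart (z : Sphere)) :=
      OnePoint.continuous_coe.comp (continuous_const.add continuous_id)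
    simpa [chart_zero] using h.tendsto 0

theorem chart_coe_image_mem_nhds {z y : ℂ} {r : ℝ} (hy : y ∈ ball z r) :
    chart (z : Sphere) '' ball 0 r ∈ 𝓝 (y : Sphere) := by
  have h : chart (z : Sphere) '' ball 0 r = (fun w : ℂ => (w : Sphere)) '' ball z r := by
    ext p
    constructor
    · rintro ⟨w, hw, rfl⟩
      exact ⟨z + w, by simpa using hw, rfl⟩
    · rintro ⟨w, hw, rfl⟩
      refine ⟨w - z, ?_, ?_⟩
      · rwa [mem_ball_zero_iff, ← mem_ball_iff_norm]
      · rw [chart_coe, add_sub_cancel]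
  rw [h]
  exact OnePoint.isOpenEmbedding_coe.image_mem_nhds.2 (isOpen_ball.mem_nhds hy)

theorem chart_infty_image_mem_nhds {r : ℝ} (hr : 0 < r) : chart ∞ '' ball 0 r ∈ 𝓝 (∞ : Sphere) := by
  rw [OnePoint.nhds_infty_eq, mem_sup]
  constructor
  · rw [coclosedCompact_eq_cocompact, mem_map]
    filter_upwards [(isCompact_closedBall (0 : ℂ) r⁻¹).compl_mem_cocompact] with w hw
    have hw' : r⁻¹ < ‖w‖ := by simpa using hw
    have hw0 : w ≠ 0 := norm_pos_iff.1 ((inv_pos.2 hr).trans hw')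
    refine ⟨w⁻¹, ?_, ?_⟩
    · rw [mem_ball_zero_iff, norm_inv]
      exact inv_lt_of_inv_lt₀ hr hw'
    · rw [chart_infty, inversion_coe, if_neg (inv_ne_zero hw0), inv_inv]
  · exact mem_pure.2 ⟨0, mem_ball_self hr, chart_zero ∞⟩

theorem HolomorphicAtFinite.comp {f : ℂ → Sphere} {φ : ℂ → ℂ} {w : ℂ}
    (hf : HolomorphicAtFinite f (φ w)) (hφ : AnalyticAt ℂ φ w) :
    HolomorphicAtFinite (fun v => f (φ v)) w := by
  obtain ⟨x, y, hx, hy, h⟩ := hf.exists_proj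
  exact holomorphicAtFinite_of_proj (hx.comp hφ) (hy.comp hφ) h.self_of_nhds.1
    ((hφ.continuousAt.eventually h).mono fun v hv => hv.2)

theorem HolomorphicAtFinite.congr {f g : ℂ → Sphere} {w : ℂ} (hf : HolomorphicAtFinite f w)
    (h : f =ᶠ[𝓝 w] g) : HolomorphicAtFinite g w := by
  obtain ⟨x, y, hx, hy, h'⟩ := hf.exists_proj
  exact holomorphicAtFinite_of_proj hx hy h'.self_of_nhds.1
    (h.symm.trans (h'.mono fun v hv => hv.2))

theorem HolomorphicAt.comp_chart {f : Sphere → Sphere} {p : Sphere} {w : ℂ}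
    (hf : HolomorphicAt f (chart p w)) : HolomorphicAtFinite (fun v => f (chart p v)) w := by
  induction p using OnePoint.rec with
  | infty =>
    rcases eq_or_ne w 0 with rfl | hw
    · rw [chart_zero] at hf
      exact hf
    · rw [chart_infty, inversion_coe, if_neg hw] at hf
      have h1 : HolomorphicAtFinite (fun v : ℂ => f (v : Sphere)) w⁻¹ := hf
      refine (h1.comp (φ := fun v => v⁻¹) (analyticAt_inv hw)).congr ?_
      filter_upwards [eventually_ne_nhds hw] with v hv
      rw [chart_infty, inversion_coe, if_neg hv]
  | coe z =>
    have h1 : HolomorphicAtFinite (fun v : ℂ => f (v : Sphere)) (z + w) := hf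
    exact h1.comp (φ := fun v => z + v) (analyticAt_const.add analyticAt_id)

theorem HolomorphicAt.of_comp_chart {f : Sphere → Sphere} {p : Sphere}
    (hf : HolomorphicAtFinite (fun v => f (chart p v)) 0) : HolomorphicAt f p := by
  induction p using OnePoint.rec with
  | infty => exact hf
  | coe z =>
    have h1 : HolomorphicAtFinite (fun v => f (chart (z : Sphere) v)) (z - z) := by rwa [sub_self]
    have h2 := h1.comp (φ := fun v => v - z) (analyticAt_id.sub analyticAt_const)
    simp only [chart_coe, add_sub_cancel] at h2
    exact h2

theorem IsMeromorphicOrInfty.comp_chart {f : Sphere → Sphere} {D : Set Sphere} {p : Sphere} {R : ℝ}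
    (hf : IsMeromorphicOrInfty f D) (hD : ∀ w ∈ ball (0 : ℂ) R, chart p w ∈ D) :
    ∀ w ∈ ball (0 : ℂ) R, HolomorphicAtFinite (fun v => f (chart p v)) w := by
  intro w hw
  rcases hf with hf | hf
  · exact (hf.1 _ (hD w hw)).comp_chart
  · refine holomorphicAtFinite_of_proj (x := fun _ => 1) (y := fun _ => 0) analyticAt_const
      analyticAt_const (Or.inl one_ne_zero) ?_
    filter_upwards [isOpen_ball.mem_nhds hw] with v hv
    rw [hf _ (hD v hv), proj_zero_right]

open scoped Classical in
/-- A family of sphere-valued functions all of whose sequences have subsequences converging to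
holomorphic maps near each point, on a neighbourhood that does not depend on the sequence, is
normal. -/
theorem isNormalFamily_of_local {F : Set (Sphere → Sphere)} {D : Set Sphere} (hne : D.Nonempty)
    (hloc : ∀ p ∈ D, ∃ r : ℝ, 0 < r ∧ (∀ w ∈ ball (0 : ℂ) r, chart p w ∈ D) ∧
      ∀ v : ℕ → Sphere → Sphere, (∀ n, v n ∈ F) → ∃ ψ : ℕ → ℕ, StrictMono ψ ∧ ∃ g : ℂ → Sphere,
        ConvergesHolomorphically (fun n w => v (ψ n) (chart p w)) g (ball 0 r)) :
    IsNormalFamily F D := by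
  intro u hu
  choose! r hr hrD hr' using hloc
  -- The Lindelöf property of ℂ gives countably many chart discs covering the finite points of `D`;
  -- the point ∞ is added separately.
  obtain ⟨T, hTD, hTc, hT⟩ := TopologicalSpace.countable_cover_nhdsWithin
    (s := {z : ℂ | (z : Sphere) ∈ D}) (f := fun z : ℂ => ball z (r (z : Sphere)))
    (fun z hz => mem_nhdsWithin_of_mem_nhds (ball_mem_nhds z (hr _ hz)))
  set S : Set Sphere := (fun z : ℂ => (z : Sphere)) '' T ∪ ({∞} ∩ D) with hS
  have hSD : S ⊆ D := by
    rintro _ (⟨z, hz, rfl⟩ | ⟨-, h⟩)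
    exacts [hTD hz, h]
  have hSc : S.Countable := (hTc.image _).union ((countable_singleton _).mono inter_subset_left)
  have hcover : ∀ y ∈ D, ∃ p ∈ S, chart p '' ball 0 (r p) ∈ 𝓝 y := by
    intro y hy
    induction y using OnePoint.rec with
    | infty => exact ⟨∞, Or.inr ⟨rfl, hy⟩, chart_infty_image_mem_nhds (hr _ hy)⟩
    | coe z =>
      obtain ⟨t, ht, hzt⟩ := mem_iUnion₂.1 (hT hy)
      exact ⟨t, Or.inl ⟨t, ht, rfl⟩, chart_coe_image_mem_nhds hzt⟩
  have hSne : S.Nonempty := by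
    obtain ⟨y, hy⟩ := hne
    obtain ⟨p, hp, -⟩ := hcover y hy
    exact ⟨p, hp⟩
  obtain ⟨e, he⟩ := hSc.exists_eq_range hSne
  have heD : ∀ k, e k ∈ D := fun k => hSD (he ▸ mem_range_self k)
  obtain ⟨φ, hφ, hP⟩ := exists_strictMono_forall
    (P := fun k φ => ∃ g : ℂ → Sphere,
      ConvergesHolomorphically (fun n w => u (φ n) (chart (e k) w)) g (ball 0 (r (e k))))
    (fun k φ _ => hr' (e k) (heD k) (fun n => u (φ n)) (fun n => hu _))
    (fun k φ φ' N ⟨g, hg⟩ h => ⟨g, hg.of_tail (N := N) fun n hn => by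
      obtain ⟨m, hm, hmn⟩ := h n hn
      exact ⟨m, hm, by rw [hmn]⟩⟩)
  have hP' : ∀ p ∈ S, ∃ g : ℂ → Sphere,
      ConvergesHolomorphically (fun n w => u (φ n) (chart p w)) g (ball 0 (r p)) := by
    intro p hp
    rw [he] at hp
    obtain ⟨k, rfl⟩ := hp
    exact hP k
  -- The limit is defined pointwise, so that the local limits agree by uniqueness of limits in the
  -- sphere; the default ∞ is used only where there is no convergence, hence never on `D`.
  let G : Sphere → Sphere := fun y =>
    if h : ∃ p, Tendsto (fun n => u (φ n) y) atTop (𝓝 p) then h.choose else ∞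
  have hG : ∀ y p, Tendsto (fun n => u (φ n) y) atTop (𝓝 p) → G y = p := by
    intro y p hp
    have hex : ∃ p, Tendsto (fun n => u (φ n) y) atTop (𝓝 p) := ⟨p, hp⟩
    simp only [G, dif_pos hex]
    exact tendsto_nhds_unique hex.choose_spec hp
  have hlim : ∀ y ∈ D, Tendsto (fun n => u (φ n) y) atTop (𝓝 (G y)) := by
    intro y hy
    obtain ⟨p, hp, hpy⟩ := hcover y hy
    obtain ⟨w, hw, rfl⟩ := mem_of_mem_nhds hpy
    obtain ⟨g, hg⟩ := hP' p hp
    have h1 := hg.tendsto w hw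
    rwa [hG _ _ h1]
  refine ⟨φ, hφ, G, ?_, fun y hy => ?_⟩
  · have hhol : ∀ y ∈ D, HolomorphicAt G y := by
      intro y hy
      -- Holomorphy at `y` is read in the chart centred at `y`, which need not be one of the
      -- countably many centres. A further subsequence converges there, necessarily to `G`.
      obtain ⟨ψ, hψ, g, hg⟩ := hr' y hy (fun n => u (φ n)) (fun n => hu _)
      have h0 : (0 : ℂ) ∈ ball (0 : ℂ) (r y) := mem_ball_self (hr y hy)
      refine HolomorphicAt.of_comp_chart ((hg.holomorphic 0 h0).congr ?_)
      filter_upwards [isOpen_ball.mem_nhds h0] with w hw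
      exact tendsto_nhds_unique (hg.tendsto w hw)
        ((hlim _ (hrD y hy w hw)).comp hψ.tendsto_atTop)
    by_cases hinf : IdenticallyInfty G D
    exacts [Or.inr hinf, Or.inl ⟨hhol, hinf⟩]
  · obtain ⟨p, hp, hpy⟩ := hcover y hy
    obtain ⟨g, hg⟩ := hP' p hp
    refine ⟨_, mem_nhdsWithin_of_mem_nhds hpy, fun δ hδ => ?_⟩
    obtain ⟨N, hN⟩ := hg.uniform δ hδ
    refine ⟨N, ?_⟩
    rintro n hn _ ⟨w, hw, rfl⟩
    rw [hG _ _ (hg.tendsto w hw)]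
    exact hN n hn w hw

end SphereNormal

/-! ### The normality criterion -/

theorem theorem1p1
    (D : Set SphereNormal.Sphere) (hD : SphereNormal.IsDomainSet D)
    (F : Set (SphereNormal.Sphere → SphereNormal.Sphere))
    (hF : ∀ f ∈ F, SphereNormal.IsMeromorphicOn f D)
    (a : (SphereNormal.Sphere → SphereNormal.Sphere) → Fin 3 →
      SphereNormal.Sphere → SphereNormal.Sphere)
    (ha : ∀ f ∈ F, ∀ j : Fin 3, SphereNormal.IsMeromorphicOrInfty (a f j) D)
    (ε : ℝ) (hε : 0 < ε)
    (hsep : ∀ f ∈ F, ∀ j k : Fin 3, j ≠ k → ∀ z ∈ D,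
      ε ≤ SphereNormal.sphericalDist (a f j z) (a f k z))
    (hshare : ∀ f ∈ F, ∀ g ∈ F, ∀ j : Fin 3,
      SphereNormal.DifferencesShareZero f (a f j) g (a g j) D) :
    SphereNormal.IsNormalFamily F D := by
  refine SphereNormal.isNormalFamily_of_local hD.2.nonempty fun p hp => ?_
  obtain ⟨R, hR, hRD⟩ := Metric.eventually_nhds_iff_ball.1
    ((SphereNormal.tendsto_chart_zero p).eventually (hD.1.mem_nhds hp))
  obtain ⟨r, M, c, hr, hc, h⟩ := SphereNormal.exists_boundedLift_of_share_targets (ι := F)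
    (f := fun i w => i.1 (SphereNormal.chart p w))
    (a := fun i j w => a i.1 j (SphereNormal.chart p w)) hR (div_pos hε Real.pi_pos)
    (fun i => SphereNormal.IsMeromorphicOrInfty.comp_chart (Or.inl (hF i.1 i.2)) hRD)
    (fun i j => SphereNormal.IsMeromorphicOrInfty.comp_chart (ha i.1 i.2 j) hRD)
    -- The spherical distance is at most π times `chord`, so spherical separation `ε` gives chordal
    -- separation `ε / π`.
    (fun i j k hjk z hz => by
      rw [div_le_iff₀' Real.pi_pos]
      exact (hsep i.1 i.2 j k hjk _ (hRD z hz)).trans (SphereNormal.sphericalDist_le _ _))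
    (fun i i' j z hz => hshare i.1 i.2 i'.1 i'.2 j _ (hRD z hz))
  have hrR : 0 < min r R := lt_min hr hR
  refine ⟨min r R / 2, half_pos hrR, fun w hw => hRD w (Metric.ball_subset_ball ?_ hw),
    fun v hv => ?_⟩
  · linarith [min_le_right r R]
  · exact SphereNormal.exists_subseq_convergesHolomorphically hrR hc fun n =>
      (h ⟨v n, hv n⟩).mono (min_le_left _ _) le_rfl le_rfl
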